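/- Let $G$ be a compact linear Lie group (a compact subgroup of the unit group of a finite-dimensional real algebra, e.g. a compact matrix group) with semisimple Lie algebra $\mathfrak g$, let $K$ be the Killing form of $\mathfrak g$, and let $\mathfrak g=\mathfrak m\oplus\mathfrak h$, $A\in\mathfrak h$, be a Hermitian symmetric structure: $[\mathfrak h,\mathfrak h]\subseteq\mathfrak h$, $[\mathfrak h,\mathfrak m]\subseteq\mathfrak m$, $[\mathfrak m,\mathfrak m]\subseteq\mathfrak h$, the centralizer of $A$ in $\mathfrak g$ is $\mathfrak h$, and $J=\mathrm{ad}(A)$ satisfies $J^2=-1$ on $\mathfrak m\neq 0$. Put $\rho^2=-K(A,A)$ with $\rho>0$, and let $H\subset G$ be the stabilizer of $A$ under $\mathrm{Ad}$. Embed the Hermitian symmetric space $M=G/H$ isometrically in $(\mathfrak g,-K)$ by $gH\mapsto \mathrm{Ad}(g)A$; its complex structure is $J_\chi=\mathrm{ad}(\chi)$ and its Levi-Civita derivative along a map is the tangential projection $\nabla_x=-J_\chi^2\partial_x$. Identify the flat space $\mathrm{Aff}(G,H)=(G\ltimes\mathfrak g)/G$ with $\mathfrak g$, with norm $|T|^2=-K(T,T)$.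 Let $I\subseteq\mathbb R$ be an open interval; everything is smooth on $x\in\mathbb R$, $t\in I$, or with $t$ in the rescaled interval $c^{-1}I$ wherever $t$ is replaced by $ct$. A *parallel frame* of $\chi:\mathbb R\times I\to M$ is a smooth $\psi:\mathbb R\times I\to G$ with $\chi=\psi H$ and $\tilde q:=\psi^{-1}\psi_x\in\mathfrak m$; its *Hasimoto variable* is $q(x,t)=\tilde q(x,\rho^2t)$. Call $\psi$ *NLS-normalized* if moreover $\psi^{-1}\psi_t=-J\tilde q_x+\tfrac12[\tilde q,J\tilde q]$. Consider $$\text{(S)}\ \ \chi_t=-J_\chi\nabla_x\chi_x,\qquad \text{(N)}\ \ \tfrac1{\rho^2}q_t=-Jq_{xx}+\tfrac12[q,[q,Jq]]\ \ (q\in\mathfrak m),$$ $$\text{(T)}\ \ T_t=\mathrm{ad}(T)^{-1}T_{xx},\qquad \text{(T$'$)}\ \ T_t=-\mathrm{ad}(T)T_{xx},$$ the last two for *spin vectors*, i.e. smooth fields $T$ in $\mathrm{Aff}(G,H)$ with $|T|=1$ and values in $\rho^{-1}\mathrm{Ad}(G)A$; here $\mathrm{ad}(T)^{-1}Y$ is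 the element $Z$ of the image of $\mathrm{ad}(T)$ for which $[T,Z]-Y$ commutes with $T$. Then: 1. Every smooth $\chi$ has a parallel frame, unique up to $\psi\mapsto\psi\,k(t)$ with smooth $k:I\to H$. 2. If $\psi$ is a parallel frame of $\chi$, then $\chi$ solves (S) if and only if for some smooth $k:I\to H$ the frame $\psi k$ is an NLS-normalized parallel frame whose Hasimoto variable solves (N). 3. A function $q$ solves (N) if and only if it is the Hasimoto variable of some solution $\chi$ of (S) in an NLS-normalized parallel frame. If the Hasimoto variable of $\chi$ in an arbitrary parallel frame solves (N), then $g(t)\cdot\chi$ solves (S) for some smooth $g:I\to G$. 4. If $q,q'$ are Hasimoto variables of $\chi,\chi'$ in NLS-normalized parallel frames, then $\chi'=g\cdot\chi$ for a constant $g\in G$ if and only if $q'=\mathrm{Ad}(k)q$ for a constant $k\in H$. The equation (N) is $\mathrm{Ad}(H)$-invariant. For an NLS-normalized parallel frame $\psi$ of $\chi$, $\chi$ is $L$-periodic in $x$ if and only if $\psi(x+L,t)=\psi(x,t)k$ for a constant $k\in H$. 5. For each constant $c>0$ the relation $T(x,t)=\rho^{-1}\chi(x,ct)$ is a correspondence between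 smooth maps $\chi$ into $M$ and spin vectors $T$: each $\chi$ comes from such a $T$ and each $T$ from such a $\chi$. Under it, $\chi$ solves (S) if and only if $T$ solves (T) when $c=\rho$, and if and only if $T$ solves (T$'$) when $c=\rho^{-1}$. A function $q$ solves (N) if and only if it is the Hasimoto variable, in an NLS-normalized parallel frame, of a map $\chi$ for which $T(x,t)=\rho^{-1}\chi(x,\rho t)$ is a spin vector that solves (T). -/

import Mathlib

open scoped ContDiff

attribute [local instance 100] LieRing.ofAssociativeRing

noncomputable section

namespace HermitianNLS

/-! ### Compact linear Lie groups, their Lie algebra and adjoint action -/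

section Ad

variable {𝔸 : Type*} [NormedRing 𝔸]

/-- `Ad(g) X = g X g⁻¹`. -/
def Ad (g : 𝔸ˣ) (X : 𝔸) : 𝔸 := (g : 𝔸) * X * ((g⁻¹ : 𝔸ˣ) : 𝔸)

theorem Ad_mul (g h : 𝔸ˣ) (X : 𝔸) : Ad (g * h) X = Ad g (Ad h X) := by
  simp [Ad, mul_assoc]

theorem Ad_one (X : 𝔸) : Ad (1 : 𝔸ˣ) X = X := by simp [Ad]

theorem Ad_lie (g : 𝔸ˣ) (X Y : 𝔸) : Ad g ⁅X, Y⁆ = ⁅Ad g X, Ad g Y⁆ := by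
  simp [Ad, Ring.lie_def, mul_sub, sub_mul, mul_assoc]

end Ad

section LieGroup

variable {𝔸 : Type*} [NormedRing 𝔸] [NormedAlgebra ℝ 𝔸]

/-- Velocities at `1` of curves in `G`, for a group `G` of units of a real normed algebra `𝔸`
(for example of real or complex matrices). -/
def IsTangent (G : Subgroup 𝔸ˣ) (X : 𝔸) : Prop :=
  ∃ c : ℝ → 𝔸ˣ, (∀ s, c s ∈ G) ∧ c 0 = 1 ∧ HasDerivAt (fun s => (c s : 𝔸)) X 0

theorem IsTangent.conj {G : Subgroup 𝔸ˣ} {X : 𝔸} (hX : IsTangent G X) {g : 𝔸ˣ} (hg : g ∈ G) :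
    IsTangent G ((g : 𝔸) * X * ((g⁻¹ : 𝔸ˣ) : 𝔸)) := by
  obtain ⟨c, hc, h0, hd⟩ := hX
  refine ⟨fun s => g * c s * g⁻¹, fun s => G.mul_mem (G.mul_mem hg (hc s)) (G.inv_mem hg),
    by simp [h0], ?_⟩
  simpa using (hd.const_mul (g : 𝔸)).mul_const ((g⁻¹ : 𝔸ˣ) : 𝔸)

/-- The tangent space of `G` at `1`, as a vector space. -/
def tangentSpace (G : Subgroup 𝔸ˣ) : Submodule ℝ 𝔸 where
  carrier := {X | IsTangent G X}
  zero_mem' := ⟨fun _ => 1, fun _ => G.one_mem, rfl, by simpa using hasDerivAt_const (0 : ℝ) (1 : 𝔸)⟩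
  add_mem' := by
    rintro X Y ⟨c, hc, c0, hX⟩ ⟨d, hd, d0, hY⟩
    refine ⟨fun s => c s * d s, fun s => G.mul_mem (hc s) (hd s), by simp [c0, d0], ?_⟩
    have := hX.mul hY
    simp only [c0, d0, Units.val_one, mul_one, one_mul] at this
    exact this
  smul_mem' := by
    rintro r X ⟨c, hc, c0, hX⟩
    refine ⟨fun s => c (r * s), fun s => hc _, by simp [c0], ?_⟩
    have h1 : HasDerivAt (fun s : ℝ => r * s) r 0 := by
      simpa using (hasDerivAt_id (0 : ℝ)).const_mul r
    have h2 : HasDerivAt (fun s => (c s : 𝔸)) X (r * 0) := by simpa using hX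
    exact h2.scomp (0 : ℝ) h1

variable [FiniteDimensional ℝ 𝔸]

/-- The Lie algebra `𝔤` of `G`: the tangent space at `1`, with the commutator bracket. -/
def lieAlg (G : Subgroup 𝔸ˣ) : LieSubalgebra ℝ 𝔸 where
  toSubmodule := tangentSpace G
  lie_mem' := by
    rintro X Y ⟨c, hc, c0, hX⟩ hY
    have : CompleteSpace 𝔸 := FiniteDimensional.complete ℝ 𝔸
    have hinv : HasDerivAt (fun s => (((c s)⁻¹ : 𝔸ˣ) : 𝔸)) (-X) 0 := by
      have h1 := hasFDerivAt_ringInverse (𝕜 := ℝ) (c 0)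
      have h2 := h1.comp_hasDerivAt (0 : ℝ) hX
      simpa [c0, Function.comp_def] using h2
    have hd : HasDerivAt (fun s => (c s : 𝔸) * Y * (((c s)⁻¹ : 𝔸ˣ) : 𝔸)) (X * Y - Y * X) 0 := by
      have := (hX.mul_const Y).mul hinv
      simp only [c0, inv_one, Units.val_one, mul_one, one_mul, mul_neg, ← sub_eq_add_neg] at this
      exact this
    have hcl : IsClosed ((tangentSpace G : Submodule ℝ 𝔸) : Set 𝔸) :=
      Submodule.closed_of_finiteDimensional _
    have ht := hasDerivAt_iff_tendsto_slope.1 hd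
    have hm : X * Y - Y * X ∈ tangentSpace G := by
      refine hcl.mem_of_tendsto ht (Filter.Eventually.of_forall fun s => ?_)
      have h1 : (c s : 𝔸) * Y * (((c s)⁻¹ : 𝔸ˣ) : 𝔸) ∈ tangentSpace G :=
        IsTangent.conj hY (hc s)
      have h2 : (c 0 : 𝔸) * Y * (((c 0)⁻¹ : 𝔸ˣ) : 𝔸) ∈ tangentSpace G :=
        IsTangent.conj hY (hc 0)
      exact (tangentSpace G).smul_mem _ ((tangentSpace G).sub_mem h1 h2)
    simpa [Ring.lie_def] using hm

theorem Ad_mem {G : Subgroup 𝔸ˣ} {g : 𝔸ˣ} (hg : g ∈ G) {X : 𝔸} (hX : X ∈ lieAlg G) :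
    Ad g X ∈ lieAlg G :=
  IsTangent.conj hX hg

/-- The adjoint representation of `G` on the additive group of `𝔤`. -/
def adHom (G : Subgroup 𝔸ˣ) : G →* MulAut (Multiplicative (lieAlg G)) where
  toFun g := AddEquiv.toMultiplicative
    { toFun := fun X => ⟨Ad (g : 𝔸ˣ) X, Ad_mem g.2 X.2⟩
      invFun := fun X => ⟨Ad ((g⁻¹ : G) : 𝔸ˣ) X, Ad_mem (g⁻¹).2 X.2⟩
      left_inv := fun X => Subtype.ext (by
        simp only [← Ad_mul, ← Subgroup.coe_mul, inv_mul_cancel, Subgroup.coe_one, Ad_one])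
      right_inv := fun X => Subtype.ext (by
        simp only [← Ad_mul, ← Subgroup.coe_mul, mul_inv_cancel, Subgroup.coe_one, Ad_one])
      map_add' := fun X Y => Subtype.ext (by simp [Ad, mul_add, add_mul]) }
  map_one' := by
    ext X
    change Ad ((1 : G) : 𝔸ˣ) _ = _
    simp [Ad_one]
  map_mul' g h := by
    ext X
    change Ad ((g * h : G) : 𝔸ˣ) _ = Ad (g : 𝔸ˣ) (Ad (h : 𝔸ˣ) _)
    simp [Ad_mul]

/-- The affine space `Aff(G,H) = (G ⋉ 𝔤) / G`, where `(g₁, a₁)(g₂, a₂) = (g₁ g₂, Ad(g₁) a₂ + a₁)`. -/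
abbrev Aff (G : Subgroup 𝔸ˣ) : Type _ :=
  (Multiplicative (lieAlg G) ⋊[adHom G] G) ⧸
    (SemidirectProduct.inr : G →* Multiplicative (lieAlg G) ⋊[adHom G] G).range

/-- The canonical identification of `Aff(G,H)` with the flat Euclidean vector space `𝔤`:
the coset of `(g, a)` corresponds to `a`. -/
def Aff.equiv (G : Subgroup 𝔸ˣ) : Aff G ≃ lieAlg G where
  toFun := Quotient.lift (fun p => Multiplicative.toAdd p.left) (by
    intro p r h
    obtain ⟨k, hk⟩ := QuotientGroup.leftRel_apply.1 h
    have : r = p * SemidirectProduct.inr k := by rw [hk]; group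
    simp [this])
  invFun a := QuotientGroup.mk (SemidirectProduct.inl (Multiplicative.ofAdd a))
  left_inv := by
    intro p
    induction p using QuotientGroup.induction_on with
    | H p =>
      refine QuotientGroup.eq.2 ⟨p.right, ?_⟩
      rw [eq_inv_mul_iff_mul_eq]
      exact SemidirectProduct.inl_left_mul_inr_right p
  right_inv := fun a => rfl

/-- The element of `𝔤`, seen in `𝔸`, that represents a vector of `Aff(G,H)`. -/
def Aff.vec {G : Subgroup 𝔸ˣ} (v : Aff G) : 𝔸 := (Aff.equiv G v : 𝔸)

/-- The squared norm of a vector of `Aff(G,H)`, from minus the Killing form of `𝔤`. -/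
def Aff.normSq {G : Subgroup 𝔸ˣ} (v : Aff G) : ℝ :=
  -killingForm ℝ (lieAlg G) (Aff.equiv G v) (Aff.equiv G v)

/-- `Z = ad(X)⁻¹ Y` in `𝔤`: `Z` lies in the image of `ad(X)`, and `[X, Z]` is `Y` up to the
centralizer of `X`. -/
def IsAdInv (G : Subgroup 𝔸ˣ) (X Y Z : 𝔸) : Prop :=
  (∃ W ∈ lieAlg G, Z = ⁅X, W⁆) ∧ ⁅X, Y - ⁅X, Z⁆⁆ = 0

/-- A Hermitian symmetric structure on `𝔤`: a splitting `𝔤 = 𝔪 ⊕ 𝔥` and `A ∈ 𝔥` whose centralizer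
is `𝔥` and for which `ad(A)` is a complex structure on `𝔪`. -/
structure HermSymm (G : Subgroup 𝔸ˣ) where
  𝔥 : Submodule ℝ 𝔸
  𝔪 : Submodule ℝ 𝔸
  A : 𝔸
  sup_eq : 𝔪 ⊔ 𝔥 = (lieAlg G).toSubmodule
  disjoint : Disjoint 𝔪 𝔥
  lie_hh : ∀ X ∈ 𝔥, ∀ Y ∈ 𝔥, ⁅X, Y⁆ ∈ 𝔥
  lie_hm : ∀ X ∈ 𝔥, ∀ Y ∈ 𝔪, ⁅X, Y⁆ ∈ 𝔪
  lie_mm : ∀ X ∈ 𝔪, ∀ Y ∈ 𝔪, ⁅X, Y⁆ ∈ 𝔥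
  A_mem : A ∈ 𝔥
  centralizer : ∀ X ∈ lieAlg G, ⁅A, X⁆ = 0 ↔ X ∈ 𝔥
  sq_eq : ∀ X ∈ 𝔪, ⁅A, ⁅A, X⁆⁆ = -X

namespace HermSymm

variable {G : Subgroup 𝔸ˣ} (D : HermSymm G)

theorem A_mem_lieAlg : D.A ∈ lieAlg G := by
  have : D.A ∈ D.𝔪 ⊔ D.𝔥 := Submodule.mem_sup_right D.A_mem
  rw [D.sup_eq] at this
  exact this

/-- The squared norm `-K(A, A)` of `A`. -/
def normSqA : ℝ := -killingForm ℝ (lieAlg G) ⟨D.A, D.A_mem_lieAlg⟩ ⟨D.A, D.A_mem_lieAlg⟩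

/-- The subgroup `H` of `G`: the stabilizer of `A` under the adjoint action. -/
def H : Subgroup G where
  carrier := {g | Ad (g : 𝔸ˣ) D.A = D.A}
  one_mem' := by simp [Ad_one]
  mul_mem' := by
    intro a b ha hb
    simp only [Set.mem_ofPred_eq] at ha hb ⊢
    rw [Subgroup.coe_mul, Ad_mul, hb, ha]
  inv_mem' := by
    intro a ha
    simp only [Set.mem_ofPred_eq] at ha ⊢
    conv_lhs => rw [← ha]
    rw [← Ad_mul, ← Subgroup.coe_mul, inv_mul_cancel, Subgroup.coe_one, Ad_one]

/-- The Hermitian symmetric space `M = G/H`. -/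
abbrev M : Type _ := G ⧸ D.H

/-- The isometric embedding `gH ↦ Ad(g) A` of `M` onto the adjoint orbit of `A` in `𝔤`. -/
def emb : D.M → 𝔸 :=
  Quotient.lift (fun g : G => Ad (g : 𝔸ˣ) D.A) (by
    intro a b h
    have h1 : Ad ((a⁻¹ * b : G) : 𝔸ˣ) D.A = D.A := QuotientGroup.leftRel_apply.1 h
    have h2 : Ad ((a * (a⁻¹ * b) : G) : 𝔸ˣ) D.A = Ad (a : 𝔸ˣ) D.A := by
      rw [Subgroup.coe_mul, Ad_mul, h1]
    rw [mul_inv_cancel_left] at h2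
    exact h2.symm)

theorem emb_injective : Function.Injective D.emb := by
  intro p r
  induction p using QuotientGroup.induction_on with
  | H a =>
    induction r using QuotientGroup.induction_on with
    | H b =>
      intro h
      replace h : Ad (a : 𝔸ˣ) D.A = Ad (b : 𝔸ˣ) D.A := h
      refine QuotientGroup.eq.2 ?_
      change Ad ((a⁻¹ * b : G) : 𝔸ˣ) D.A = D.A
      rw [Subgroup.coe_mul, Ad_mul, ← h, ← Ad_mul, ← Subgroup.coe_mul, inv_mul_cancel,
        Subgroup.coe_one, Ad_one]

/-- The Hermitian structure `J_p = ad(p)` of `M`; the tangent space at `p`, seen in `𝔤`, is the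
image of `ad(p)`. -/
def Jmap (p : D.M) (Y : 𝔸) : 𝔸 := ⁅D.emb p, Y⁆

/-- `-J_p²` is the projection of `𝔤` onto the tangent space of `M` at `p`, that is onto the image
of `ad(p)`, along the kernel of `ad(p)`, its orthogonal complement for the Killing form. -/
def tangentProj (p : D.M) (Y : 𝔸) : 𝔸 := -D.Jmap p (D.Jmap p Y)

theorem Jmap_cube (p : D.M) {Y : 𝔸} (hY : Y ∈ lieAlg G) :
    D.Jmap p (D.Jmap p (D.Jmap p Y)) = -D.Jmap p Y := by
  induction p using QuotientGroup.induction_on with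
  | H g =>
    have key : ∀ X ∈ lieAlg G, ⁅D.A, ⁅D.A, ⁅D.A, X⁆⁆⁆ = -⁅D.A, X⁆ := by
      intro X hX
      have hX' : X ∈ D.𝔪 ⊔ D.𝔥 := by rw [D.sup_eq]; exact hX
      obtain ⟨y, hy, z, hz, rfl⟩ := Submodule.mem_sup.1 hX'
      have hz' : z ∈ lieAlg G := by
        have : z ∈ D.𝔪 ⊔ D.𝔥 := Submodule.mem_sup_right hz
        rw [D.sup_eq] at this
        exact this
      rw [lie_add, (D.centralizer z hz').2 hz, add_zero, D.sq_eq _ (D.lie_hm _ D.A_mem _ hy)]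
    have hY' : Y = Ad (g : 𝔸ˣ) (Ad ((g⁻¹ : G) : 𝔸ˣ) Y) := by
      rw [← Ad_mul, ← Subgroup.coe_mul, mul_inv_cancel, Subgroup.coe_one, Ad_one]
    have hm := Ad_mem (g⁻¹).2 hY
    set X := Ad ((g⁻¹ : G) : 𝔸ˣ) Y
    have := congrArg (Ad (g : 𝔸ˣ)) (key X hm)
    change ⁅Ad (g : 𝔸ˣ) D.A, ⁅Ad (g : 𝔸ˣ) D.A, ⁅Ad (g : 𝔸ˣ) D.A, Y⁆⁆⁆ = -⁅Ad (g : 𝔸ˣ) D.A, Y⁆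
    rw [hY', ← Ad_lie, ← Ad_lie, ← Ad_lie, this, Ad, Ad, mul_neg, neg_mul]

theorem tangentProj_idem (p : D.M) {Y : 𝔸} (hY : Y ∈ lieAlg G) :
    D.tangentProj p (D.tangentProj p Y) = D.tangentProj p Y := by
  have h : ⁅D.emb p, ⁅D.emb p, ⁅D.emb p, Y⁆⁆⁆ = -⁅D.emb p, Y⁆ := D.Jmap_cube p hY
  simp only [tangentProj, Jmap, lie_neg, h, neg_neg]

end HermSymm

end LieGroup

/-! ### Functions of `(x, t)` -/

section Calculus

variable {V : Type*} [NormedAddCommGroup V] [NormedSpace ℝ V]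

/-- `f(x,t)` is smooth for `x ∈ ℝ`, `t ∈ I`. -/
def Smooth (I : Set ℝ) (f : ℝ → ℝ → V) : Prop :=
  ContDiffOn ℝ ∞ (fun p : ℝ × ℝ => f p.1 p.2) (Set.univ ×ˢ I)

/-- `∂f/∂x`. -/
def dx (f : ℝ → ℝ → V) (x t : ℝ) : V := deriv (fun y => f y t) x

/-- `∂f/∂t`. -/
def dt (f : ℝ → ℝ → V) (x t : ℝ) : V := deriv (fun s => f x s) t

end Calculus

/-- The times `t` with `c t ∈ I`. -/
def scaleTime (c : ℝ) (I : Set ℝ) : Set ℝ := {t | c * t ∈ I}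

/-! ### The three evolution equations -/

section Equations

variable {𝔸 : Type*} [NormedRing 𝔸] [NormedAlgebra ℝ 𝔸] [FiniteDimensional ℝ 𝔸]
variable {G : Subgroup 𝔸ˣ} (D : HermSymm G)

namespace HermSymm

/-- `χ(x,t)` is a smooth map into `M ⊂ 𝔤`, for `t ∈ I`. -/
def SmoothMap (I : Set ℝ) (χ : ℝ → ℝ → D.M) : Prop := Smooth I (fun x t => D.emb (χ x t))

/-- The Levi-Civita derivative `∇ₓ Y` of a tangent vector field `Y` along `χ`: the tangential
projection of the `x`-derivative in the ambient Euclidean space. -/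
def covDx (χ : ℝ → ℝ → D.M) (Y : ℝ → ℝ → 𝔸) (x t : ℝ) : 𝔸 := D.tangentProj (χ x t) (dx Y x t)

/-- The Schrödinger map equation `χ_t = -J_χ ∇ₓ χ_x` on `M`, for `x ∈ ℝ` and `t ∈ I`. -/
def SchrodingerMap (I : Set ℝ) (χ : ℝ → ℝ → D.M) : Prop :=
  ∀ x, ∀ t ∈ I, dt (fun x t => D.emb (χ x t)) x t =
    -D.Jmap (χ x t) (D.covDx χ (dx (fun x t => D.emb (χ x t))) x t)

/-- `q` is a smooth `𝔪`-valued solution of the NLS flow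
`q_t / ‖A‖² = -J q_xx + ½ [q, [q, J q]]`, `J = ad(A)`, for `x ∈ ℝ` and `t ∈ I`. -/
structure NLS (I : Set ℝ) (q : ℝ → ℝ → 𝔸) : Prop where
  smooth : Smooth I q
  mem : ∀ x, ∀ t ∈ I, q x t ∈ D.𝔪
  eqn : ∀ x, ∀ t ∈ I, (1 / D.normSqA) • dt q x t =
    -⁅D.A, dx (dx q) x t⁆ + (1 / 2 : ℝ) • ⁅q x t, ⁅q x t, ⁅D.A, q x t⁆⁆⁆

/-- `T` is a smooth unit vector field in `Aff(G,H)` of the algebraic type of the tangent vectors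
of the non-stretching curves considered: `T = ‖A‖⁻¹ Ad(ψ) A` pointwise, with `ψ ∈ G`. -/
structure SpinVector (I : Set ℝ) (T : ℝ → ℝ → Aff G) : Prop where
  smooth : Smooth I (fun x t => (T x t).vec)
  unit : ∀ x, ∀ t ∈ I, (T x t).normSq = 1
  type : ∀ x, ∀ t ∈ I, ∃ g ∈ G, (T x t).vec = (√D.normSqA)⁻¹ • Ad g D.A

end HermSymm

/-- The general Heisenberg spin model `T_t = ad(T)⁻¹ T_xx`. -/
def Heisenberg (I : Set ℝ) (T : ℝ → ℝ → Aff G) : Prop :=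
  ∀ x, ∀ t ∈ I, IsAdInv G (T x t).vec
    (dx (dx fun x t => (T x t).vec) x t) (dt (fun x t => (T x t).vec) x t)

/-- The general Heisenberg spin model in the normalization `T_t = -ad(T) T_xx`. -/
def Heisenberg' (I : Set ℝ) (T : ℝ → ℝ → Aff G) : Prop :=
  ∀ x, ∀ t ∈ I, dt (fun x t => (T x t).vec) x t =
    -⁅(T x t).vec, dx (dx fun x t => (T x t).vec) x t⁆

/-! ### Hasimoto variable -/

/-- `ψ⁻¹ ∂ψ/∂x`. -/
def hasimoto (ψ : ℝ → ℝ → G) (x t : ℝ) : 𝔸 :=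
  (((ψ x t : 𝔸ˣ)⁻¹ : 𝔸ˣ) : 𝔸) * dx (fun x t => ((ψ x t : 𝔸ˣ) : 𝔸)) x t

/-- `ψ⁻¹ ∂ψ/∂t`. -/
def frameVel (ψ : ℝ → ℝ → G) (x t : ℝ) : 𝔸 :=
  (((ψ x t : 𝔸ˣ)⁻¹ : 𝔸ˣ) : 𝔸) * dt (fun x t => ((ψ x t : 𝔸ˣ) : 𝔸)) x t

namespace HermSymm

/-- `ψ` is a parallel frame of the map `χ = ψH`: a smooth lift to `G` with `ψ⁻¹ ψ_x ∈ 𝔪`. -/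
structure ParallelFrame (I : Set ℝ) (χ : ℝ → ℝ → D.M) (ψ : ℝ → ℝ → G) : Prop where
  smooth : Smooth I (fun x t => ((ψ x t : 𝔸ˣ) : 𝔸))
  lift : ∀ x, ∀ t ∈ I, χ x t = QuotientGroup.mk (ψ x t)
  mem : ∀ x, ∀ t ∈ I, hasimoto ψ x t ∈ D.𝔪

/-- `q` is the Hasimoto variable of `χ` in the parallel frame `ψ`, in the time variable of the NLS
flow, and the frame evolves by the connection variables of the NLS flow:
with `q̃ = ψ⁻¹ ψ_x` and `w = ψ⁻¹ ψ_t` one has `q(x,t) = q̃(x, ‖A‖² t)` and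
`w = -J q̃_x + ½ [q̃, J q̃]`. -/
structure HasimotoFrame (I : Set ℝ) (χ : ℝ → ℝ → D.M) (ψ : ℝ → ℝ → G) (q : ℝ → ℝ → 𝔸) :
    Prop where
  parallel : D.ParallelFrame I χ ψ
  q_eq : ∀ x, ∀ t ∈ scaleTime D.normSqA I, q x t = hasimoto ψ x (D.normSqA * t)
  vel : ∀ x, ∀ t ∈ I, frameVel ψ x t =
    -⁅D.A, dx (hasimoto ψ) x t⁆ + (1 / 2 : ℝ) • ⁅hasimoto ψ x t, ⁅D.A, hasimoto ψ x t⁆⁆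

/-- `T(x,t) = ‖A‖⁻¹ χ(x, c t)` for `x ∈ ℝ` and `c t ∈ I`, under `M ⊂ 𝔤 ≃ Aff(G,H)`. -/
def Corresponds (c : ℝ) (I : Set ℝ) (χ : ℝ → ℝ → D.M) (T : ℝ → ℝ → Aff G) : Prop :=
  ∀ x, ∀ t ∈ scaleTime c I, (T x t).vec = (√D.normSqA)⁻¹ • D.emb (χ x (c * t))

end HermSymm

end Equations

end HermitianNLS

end

open HermitianNLS

/-!
In a parallel frame `ψ_x = ψ u`, `u ∈ 𝔪`, the map `χ = ψ H` satisfies `χ_x = Ad(ψ) [u, A]` and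
`∇ₓ χ_x = Ad(ψ) [u_x, A]`. Zero curvature, `u_t - w_x = [u, w]` for `w = ψ⁻¹ ψ_t`, turns
statements about `χ` into statements about the defect of `ψ`, the difference of `w` and the
normalized velocity `-J u_x + ½ [u, J u]`. If `χ` is a Schrödinger map, the defect takes its values
in `𝔥` and does not depend on `x`, so a gauge transformation `k(t) ∈ H` removes it. If the Hasimoto
variable solves the NLS equation, `Ad(ψ)` of the defect does not depend on `x`, so a rigid motion
`g(t) ∈ G` removes it.

Parallel frames solve `ψ_x = ψ u`. Linear equations whose coefficients depend smoothly on a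
parameter are solved by inverting `1 - V`, `V` the Volterra operator, in the Banach space
`C([0,1], 𝔸)`: inversion is smooth, hence so is the dependence of the solution on the parameter. The
solution stays in the compact group `G`, because its distance to `G` satisfies a Grönwall
inequality.

The orbit of `A` consists of points `P` with `ad(P)³ = -ad(P)` on `𝔤`. Differentiating this identity
at `A` shows, `𝔤` being semisimple, that the velocities of curves in the orbit lie in `𝔪`, so that
`ad(χ)² = -1` on them. This makes the Schrödinger map equation a Heisenberg spin model.
-/

noncomputable section

namespace HermitianNLS

/-! ### Currying smooth functions -/

section Curry

open Set Filter Topology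

section Topology

variable {N P F : Type*} [TopologicalSpace N] [TopologicalSpace P] [TopologicalSpace F]
  {K : Set N} {U : Set P} {W : Set (P × N)} {f : P × N → F}

theorem continuousOn_curry (hUW : U ×ˢ K ⊆ W) (hf : ContinuousOn f W) {g : P → C(K, F)}
    (hg : ∀ p ∈ U, ∀ s : K, g p s = f (p, s)) : ContinuousOn g U := by
  rw [continuousOn_iff_continuous_domRestrict]
  have hf' : Continuous fun q : U × K => f (q.1, q.2) :=
    hf.comp_continuous (by fun_prop) fun q => hUW ⟨q.1.2, q.2.2⟩
  have hgf : U.domRestrict g = ContinuousMap.curry ⟨_, hf'⟩ := by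
    funext p
    ext s
    exact hg p p.2 s
  exact hgf ▸ (ContinuousMap.curry _).continuous

theorem exists_curry [Nonempty F] (hUW : U ×ˢ K ⊆ W) (hf : ContinuousOn f W) :
    ∃ g : P → C(K, F), ∀ p ∈ U, ∀ s : K, g p s = f (p, s) := by
  classical
  have hf' : ∀ p ∈ U, Continuous fun s : K => f (p, s) := fun p hp =>
    hf.comp_continuous (by fun_prop) fun s => hUW ⟨hp, s.2⟩
  exact ⟨fun p => if h : p ∈ U then ⟨_, hf' p h⟩ else .const K (Classical.arbitrary F),
    fun p hp s => by simp [hp]⟩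

end Topology

variable {N P F : Type*} {K : Set N}
  [NormedAddCommGroup N] [CompactSpace K] [NormedAddCommGroup P] [NormedSpace ℝ P]
  [NormedAddCommGroup F] [NormedSpace ℝ F]

/-- The linear map `h ↦ (s ↦ L s h)` into `C(K, F)` given by a continuous family `L` of linear
maps. -/
def familyCLM : C(K, P →L[ℝ] F) →L[ℝ] P →L[ℝ] C(K, F) :=
  LinearMap.mkContinuous₂
    (LinearMap.mk₂ ℝ
      (fun (L : C(K, P →L[ℝ] F)) h => (⟨fun s => L s h, by fun_prop⟩ : C(K, F)))
      (fun _ _ _ => rfl) (fun _ _ _ => rfl) (fun L _ _ => by ext s; exact map_add (L s) _ _)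
      (fun _ L _ => by ext s; exact map_smul (L s) _ _))
    1 fun L h => (ContinuousMap.norm_le _ (by positivity)).2 fun s => by
      rw [one_mul]
      exact (L s).le_of_opNorm_le (L.norm_coe_le_norm s) h

theorem familyCLM_apply (L : C(K, P →L[ℝ] F)) (h : P) (s : K) : familyCLM L h s = L s h := rfl

variable [NormedSpace ℝ N] {U : Set P} {W : Set (P × N)}

theorem hasFDerivAt_curry {f : P × N → F} {g : P → C(K, F)} (hU : IsOpen U) (hW : IsOpen W)
    (hUW : U ×ˢ K ⊆ W) (hf : ContDiffOn ℝ 1 f W)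
    (hg : ∀ p ∈ U, ∀ s : K, g p s = f (p, s))
    {g' : P → C(K, P →L[ℝ] F)}
    (hg' : ∀ p ∈ U, ∀ s : K, g' p s = (fderiv ℝ f (p, s)).comp (.inl ℝ P N))
    {p : P} (hp : p ∈ U) : HasFDerivAt g (familyCLM (g' p)) p := by
  have hg'c : ContinuousOn g' U :=
    continuousOn_curry (f := fun q => (fderiv ℝ f q).comp (.inl ℝ P N)) hUW
      ((hf.continuousOn_fderiv_of_isOpen hW le_rfl).clm_comp continuousOn_const) hg'
  refine .of_isLittleO (Asymptotics.isLittleO_iff.2 fun ε hε => ?_)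
  have hclose := (hg'c.continuousAt (hU.mem_nhds hp)).preimage_mem_nhds
    (Metric.closedBall_mem_nhds (g' p) hε)
  obtain ⟨δ, hδ, hball⟩ := Metric.mem_nhds_iff.1 (inter_mem hclose (hU.mem_nhds hp))
  filter_upwards [Metric.ball_mem_nhds p hδ] with p' hp'
  refine (ContinuousMap.norm_le _ (by positivity)).2 fun s => ?_
  simp only [ContinuousMap.sub_apply, familyCLM_apply, hg _ hp, hg _ (hball hp').2]
  refine Convex.norm_image_sub_le_of_norm_hasFDerivWithin_le' (f := fun q => f (q, (s : N)))
    (f' := fun q => g' q s) (s := Metric.ball p δ) (fun q hq => ?_) (fun q hq => ?_)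
    (convex_ball _ _) (Metric.mem_ball_self hδ) hp'
  · have hd : HasFDerivAt f (fderiv ℝ f (q, (s : N))) (q, (s : N)) :=
      ((hf.contDiffAt (hW.mem_nhds (hUW ⟨(hball hq).2, s.2⟩))).differentiableAt
        one_ne_zero).hasFDerivAt
    rw [hg' q (hball hq).2]
    exact (hd.comp q (hasFDerivAt_prodMk_left q (s : N))).hasFDerivWithinAt
  · exact ((g' q - g' p).norm_coe_le_norm s).trans (mem_closedBall_iff_norm.1 (hball hq).1)

section

universe u v

variable {P : Type u} [NormedAddCommGroup P] [NormedSpace ℝ P] {U : Set P} {W : Set (P × N)}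

theorem contDiffOn_curry_nat (hU : IsOpen U)
    (hW : IsOpen W) (hUW : U ×ˢ K ⊆ W) (n : ℕ) : ∀
      {F : Type (max u v)} [NormedAddCommGroup F] [NormedSpace ℝ F] {f : P × N → F}
      {g : P → C(K, F)}, ContDiffOn ℝ n f W → (∀ p ∈ U, ∀ s : K, g p s = f (p, s)) →
      ContDiffOn ℝ n g U := by
  induction n with
  | zero =>
    intro F _ _ f g hf hg
    exact contDiffOn_zero.2 (continuousOn_curry hUW hf.continuousOn hg)
  | succ n ih =>
    intro F _ _ f g hf hg
    rw [Nat.cast_add, Nat.cast_one] at hf ⊢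
    have hf' := ((contDiffOn_succ_iff_fderiv_of_isOpen hW).1 hf).2.2.clm_comp
      (contDiffOn_const (c := ContinuousLinearMap.inl ℝ P N))
    obtain ⟨g', hg'⟩ := exists_curry hUW hf'.continuousOn
    have hderiv : ∀ p ∈ U, HasFDerivAt g (familyCLM (g' p)) p := fun p hp =>
      hasFDerivAt_curry hU hW hUW (hf.of_le (by norm_cast; lia)) hg hg' hp
    refine (contDiffOn_succ_iff_fderiv_of_isOpen hU).2
      ⟨fun p hp => (hderiv p hp).differentiableAt.differentiableWithinAt, by simp, ?_⟩
    have hg'n : ContDiffOn ℝ n g' U := ih hf' hg'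
    have hsmooth : ContDiffOn ℝ n (familyCLM ∘ g') U :=
      (ContinuousLinearMap.contDiff familyCLM).comp_contDiffOn hg'n
    exact hsmooth.congr fun p hp => (hderiv p hp).fderiv

theorem contDiffOn_curry {F : Type (max u v)} [NormedAddCommGroup F] [NormedSpace ℝ F]
    {f : P × N → F} {g : P → C(K, F)} (hU : IsOpen U) (hW : IsOpen W)
    (hUW : U ×ˢ K ⊆ W) (hf : ContDiffOn ℝ ∞ f W)
    (hg : ∀ p ∈ U, ∀ s : K, g p s = f (p, s)) : ContDiffOn ℝ ∞ g U :=
  contDiffOn_infty.2 fun n =>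
    contDiffOn_curry_nat hU hW hUW n (hf.of_le (by exact_mod_cast le_top)) hg

end

end Curry

/-! ### The Volterra operator -/

section Volterra

open Set Filter Topology

section OneSub

variable {R : Type*} [NormedRing R] [CompleteSpace R]

theorem isUnit_one_sub_of_norm_pow_lt_one {x : R} {n : ℕ} (hx : ‖x ^ n‖ < 1) :
    IsUnit (1 - x) := by
  have hunit := isUnit_one_sub_of_norm_lt_one hx
  rw [← mul_neg_geom_sum] at hunit
  refine ((Commute.isUnit_mul_iff ?_).1 hunit).1
  exact (Commute.one_left _).sub_left (Commute.sum_right _ _ _ fun i _ => Commute.self_pow _ _)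

theorem contDiff_ringInverse_one_sub {Y : Type*} [NormedAddCommGroup Y] [NormedSpace ℝ Y]
    [NormedAlgebra ℝ R] {n : WithTop ℕ∞} (L : Y →L[ℝ] R) (hL : ∀ y, IsUnit (1 - L y)) :
    ContDiff ℝ n fun y => Ring.inverse (1 - L y) := by
  refine contDiff_iff_contDiffAt.2 fun y => ?_
  obtain ⟨w, hw⟩ := hL y
  have hinv : ContDiffAt ℝ n Ring.inverse (1 - L y) := hw ▸ contDiffAt_ringInverse ℝ w
  exact hinv.comp y (contDiff_const.sub L.contDiff).contDiffAt

theorem contDiff_ringInverse_one_sub_apply {E Y : Type*} [NormedAddCommGroup E] [NormedSpace ℝ E]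
    [CompleteSpace E] [NormedAddCommGroup Y] [NormedSpace ℝ Y] {n : WithTop ℕ∞}
    (L : Y →L[ℝ] E →L[ℝ] E) (hL : ∀ y, IsUnit (1 - L y)) (c : E) :
    ContDiff ℝ n fun y => Ring.inverse (1 - L y) c :=
  (contDiff_ringInverse_one_sub L hL).clm_apply contDiff_const

end OneSub

section Primitive

variable {E : Type*} [NormedAddCommGroup E] [NormedSpace ℝ E]

/-- The operator `v ↦ (s ↦ ∫₀ˢ v)` on continuous functions on `[0, 1]`. The functions are extended
constantly to the line only to write an interval integral; `primitive_apply` removes the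
extension. -/
def primitive : C(unitInterval, E) →L[ℝ] C(unitInterval, E) :=
  LinearMap.mkContinuous
    { toFun := fun v => ⟨fun s => ∫ r in (0 : ℝ)..s, v.IccExtend zero_le_one r,
        (intervalIntegral.continuous_primitive
          (fun _ _ => (map_continuous _).intervalIntegrable _ _) 0).comp continuous_subtype_val⟩
      map_add' := fun v w => by
        ext s
        exact intervalIntegral.integral_add
          ((v.IccExtend zero_le_one).continuous.intervalIntegrable _ _)
          ((w.IccExtend zero_le_one).continuous.intervalIntegrable _ _)
      map_smul' := fun r v => by
        ext s
        exact intervalIntegral.integral_smul r (v.IccExtend zero_le_one) }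
    1 fun v => (ContinuousMap.norm_le _ (by positivity)).2 fun s => by
      refine (intervalIntegral.norm_integral_le_of_norm_le_const (C := ‖v‖)
        fun r _ => v.norm_coe_le_norm _).trans ?_
      rw [sub_zero, abs_of_nonneg s.2.1, one_mul]
      exact mul_le_of_le_one_right (norm_nonneg _) s.2.2

theorem primitive_apply {v : C(unitInterval, E)} {f : ℝ → E} (hvf : ∀ r : unitInterval, v r = f r)
    (s : unitInterval) : primitive v s = ∫ r in (0 : ℝ)..s, f r := by
  refine intervalIntegral.integral_congr fun r hr => ?_
  rw [uIcc_of_le s.2.1] at hr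
  exact (IccExtend_of_mem _ _ ⟨hr.1, hr.2.trans s.2.2⟩).trans (hvf ⟨r, _⟩)

theorem primitive_mul (v : C(unitInterval, E)) (s r : unitInterval) :
    primitive v (s * r) = (s : ℝ) • primitive (v.comp (.mulLeft s)) r := by
  have hv : ∀ x : unitInterval, v x = v.IccExtend zero_le_one x := fun x =>
    (IccExtend_val zero_le_one v x).symm
  have hvs : ∀ x : unitInterval, v.comp (.mulLeft s) x = v.IccExtend zero_le_one (s * x : ℝ) :=
    fun x => hv (s * x)
  rw [primitive_apply hv, primitive_apply (f := fun x => v.IccExtend zero_le_one (s * x : ℝ)) hvs,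
    Icc.coe_mul, intervalIntegral.smul_integral_comp_mul_left, mul_zero]

end Primitive

variable {𝔸 : Type*} [NormedRing 𝔸] [NormedAlgebra ℝ 𝔸]

/-- The Volterra operator `v ↦ (s ↦ ∫₀ˢ v a)` with kernel `a`, as a linear function of `a`. -/
def volterra : C(unitInterval, 𝔸) →L[ℝ] C(unitInterval, 𝔸) →L[ℝ] C(unitInterval, 𝔸) :=
  (ContinuousLinearMap.compL ℝ _ _ _ primitive).comp (ContinuousLinearMap.mul ℝ _).flip

theorem volterra_apply (a v : C(unitInterval, 𝔸)) : volterra a v = primitive (v * a) := rfl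

theorem norm_volterra_pow_apply_le (a v : C(unitInterval, 𝔸)) (n : ℕ) (s : unitInterval) :
    ‖(volterra a ^ n) v s‖ ≤ (‖a‖ * s) ^ n / n.factorial * ‖v‖ := by
  induction n generalizing s with
  | zero => simpa using v.norm_coe_le_norm s
  | succ n ih =>
    have hbound : ∀ r ∈ Ioc (0 : ℝ) s, ‖((volterra a ^ n) v * a).IccExtend zero_le_one r‖ ≤
        ‖a‖ ^ (n + 1) / n.factorial * ‖v‖ * r ^ n := fun r hr => by
      have hr' : r ∈ Icc (0 : ℝ) 1 := ⟨hr.1.le, hr.2.trans s.2.2⟩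
      rw [ContinuousMap.coe_IccExtend, IccExtend_of_mem _ _ hr', ContinuousMap.mul_apply]
      calc _ ≤ (‖a‖ * r) ^ n / n.factorial * ‖v‖ * ‖a‖ :=
            norm_mul_le_of_le (ih ⟨r, hr'⟩) (a.norm_coe_le_norm _)
        _ = _ := by rw [mul_pow]; ring
    rw [pow_succ', mul_apply_eq_comp, volterra_apply]
    calc _ ≤ ∫ r in (0 : ℝ)..s, ‖a‖ ^ (n + 1) / n.factorial * ‖v‖ * r ^ n :=
          intervalIntegral.norm_integral_le_of_norm_le s.2.1 (MeasureTheory.ae_of_all _ hbound)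
            (Continuous.intervalIntegrable (by fun_prop) _ _)
      _ = _ := by
          rw [intervalIntegral.integral_const_mul, integral_pow, Nat.factorial_succ]
          push_cast
          field_simp
          ring

variable [CompleteSpace 𝔸]

theorem isUnit_one_sub_volterra (a : C(unitInterval, 𝔸)) : IsUnit (1 - volterra a) := by
  obtain ⟨n, hn⟩ := ((FloorSemiring.tendsto_pow_div_factorial_atTop ‖a‖).eventually_lt_const
    (zero_lt_one' ℝ)).exists
  have hnorm : ‖volterra a ^ n‖ ≤ ‖a‖ ^ n / n.factorial :=
    ContinuousLinearMap.opNorm_le_bound _ (by positivity) fun v =>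
      (ContinuousMap.norm_le _ (by positivity)).2 fun s => by
        refine (norm_volterra_pow_apply_le a v n s).trans ?_
        have := s.2.1
        gcongr
        exact mul_le_of_le_one_right (norm_nonneg _) s.2.2
  exact isUnit_one_sub_of_norm_pow_lt_one (R := C(unitInterval, 𝔸) →L[ℝ] C(unitInterval, 𝔸))
    (hnorm.trans_lt hn)

/-- The solution on `[0, 1]` of the linear equation `v' = v a` with `v(0) = 1`. -/
def volterraSol (a : C(unitInterval, 𝔸)) : C(unitInterval, 𝔸) := Ring.inverse (1 - volterra a) 1

theorem eq_volterraSol_iff {a v : C(unitInterval, 𝔸)} :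
    v = volterraSol a ↔ v = 1 + primitive (v * a) := by
  have hunit := isUnit_one_sub_volterra a
  have hv : v = 1 + primitive (v * a) ↔ (1 - volterra a) v = 1 := sub_eq_iff_eq_add.symm
  rw [hv, volterraSol]
  refine ⟨?_, fun h => ?_⟩
  · rintro rfl
    rw [← mul_apply_eq_comp, Ring.mul_inverse_cancel _ hunit]
    rfl
  · rw [← h, ← mul_apply_eq_comp, Ring.inverse_mul_cancel _ hunit]
    rfl

theorem volterraSol_mul (a : C(unitInterval, 𝔸)) (s r : unitInterval) :
    volterraSol a (s * r) = volterraSol ((s : ℝ) • a.comp (.mulLeft s)) r := by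
  suffices h : (volterraSol a).comp (.mulLeft s) = volterraSol ((s : ℝ) • a.comp (.mulLeft s)) from
    congr($h r)
  refine eq_volterraSol_iff.2 (ContinuousMap.ext fun r => ?_)
  have hsol := congr($(eq_volterraSol_iff.1 (rfl : volterraSol a = _)) (s * r))
  rw [ContinuousMap.add_apply, primitive_mul] at hsol
  rw [mul_smul_comm, map_smul]
  exact hsol

theorem contDiff_volterraSol {n : WithTop ℕ∞} :
    ContDiff ℝ n (volterraSol : C(unitInterval, 𝔸) → C(unitInterval, 𝔸)) :=
  contDiff_ringInverse_one_sub_apply (volterra (𝔸 := 𝔸)) isUnit_one_sub_volterra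
    (1 : C(unitInterval, 𝔸))

end Volterra

/-! ### Linear differential equations in a Banach algebra, with smooth parameters -/

section LinearODE

open Set Filter Topology

theorem hasDerivAt_of_eq_add_integral {E : Type*} [NormedAddCommGroup E] [NormedSpace ℝ E]
    [CompleteSpace E] {S : Set ℝ} (hS : IsOpen S) {f y : ℝ → E} {c : E} {x₀ x : ℝ}
    (hf : ContinuousOn f S) (hy : ∀ z ∈ S, y z = c + ∫ r in x₀..z, f r) (hx : uIcc x₀ x ⊆ S) :
    HasDerivAt y (f x) x := by
  have hxS : x ∈ S := hx right_mem_uIcc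
  have hderiv := intervalIntegral.integral_hasDerivAt_right (hf.mono hx).intervalIntegrable
    (hf.stronglyMeasurableAtFilter hS x hxS) (hf.continuousAt (hS.mem_nhds hxS))
  refine (hderiv.const_add c).congr_of_eventuallyEq ?_
  filter_upwards [hS.mem_nhds hxS] with z hz using hy z hz

/-- `Ω ⊆ ℝ × P` is star-shaped towards `0` in its first variable: the natural domain for solving
an ordinary differential equation from `0` in that variable. -/
def StarFst {P : Type*} (Ω : Set (ℝ × P)) : Prop :=
  ∀ p ∈ Ω, ∀ s ∈ Icc (0 : ℝ) 1, (s * p.1, p.2) ∈ Ω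

theorem StarFst.uIcc_subset {P : Type*} {Ω : Set (ℝ × P)} (hΩ : StarFst Ω) {p : ℝ × P}
    (hp : p ∈ Ω) : uIcc 0 p.1 ⊆ {x | (x, p.2) ∈ Ω} := by
  intro z hz
  rw [← segment_eq_uIcc, segment_eq_image] at hz
  obtain ⟨s, hs, rfl⟩ := hz
  simpa using hΩ p hp s hs

variable {P : Type} [NormedAddCommGroup P] [NormedSpace ℝ P]
  {𝔸 : Type*} [NormedRing 𝔸] [NormedAlgebra ℝ 𝔸]
  {Ω : Set (ℝ × P)} {u : ℝ × P → 𝔸}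

theorem exists_contDiffOn_rescaled (hΩo : IsOpen Ω) (hΩ : StarFst Ω) (hu : ContDiffOn ℝ ∞ u Ω) :
    ∃ a : ℝ × P → C(unitInterval, 𝔸), ContDiffOn ℝ ∞ a Ω ∧
      ∀ p ∈ Ω, ∀ s : unitInterval, a p s = p.1 • u (s * p.1, p.2) := by
  let scale : (ℝ × P) × ℝ → ℝ × P := fun q => (q.2 * q.1.1, q.1.2)
  have hscale : ContDiff ℝ ∞ scale := by fun_prop
  have hW : IsOpen (scale ⁻¹' Ω) := hΩo.preimage hscale.continuous
  have hΩW : Ω ×ˢ unitInterval ⊆ scale ⁻¹' Ω := fun q hq => hΩ _ hq.1 _ hq.2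
  have hf : ContDiffOn ℝ ∞ (fun q => q.1.1 • u (scale q)) (scale ⁻¹' Ω) :=
    (by fun_prop : ContDiff ℝ ∞ fun q : (ℝ × P) × ℝ => q.1.1).contDiffOn.smul
      (hu.comp hscale.contDiffOn (mapsTo_preimage scale Ω))
  obtain ⟨a, ha⟩ := exists_curry hΩW hf.continuousOn
  exact ⟨a, contDiffOn_curry hΩo hW hΩW hf ha, ha⟩

theorem exists_linearODE [CompleteSpace 𝔸] (hΩo : IsOpen Ω) (hΩ : StarFst Ω)
    (hu : ContDiffOn ℝ ∞ u Ω) :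
    ∃ y : ℝ × P → 𝔸, ContDiffOn ℝ ∞ y Ω ∧ (∀ p, (0, p) ∈ Ω → y (0, p) = 1) ∧
      ∀ p ∈ Ω, HasDerivAt (fun x => y (x, p.2)) (y p * u p) p.1 := by
  obtain ⟨a, ha, hau⟩ := exists_contDiffOn_rescaled hΩo hΩ hu
  let y : ℝ × P → 𝔸 := fun p => volterraSol (a p) 1
  have heval : ContDiff ℝ ∞ fun v : C(unitInterval, 𝔸) => v 1 :=
    (ContinuousMap.evalCLM ℝ (1 : unitInterval) : C(unitInterval, 𝔸) →L[ℝ] 𝔸).contDiff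
  have hy : ContDiffOn ℝ ∞ y Ω :=
    heval.comp_contDiffOn (contDiff_volterraSol.comp_contDiffOn ha)
  have hy_scale : ∀ p ∈ Ω, ∀ s : unitInterval, y (s * p.1, p.2) = volterraSol (a p) s := by
    intro p hp s
    have ha_scale : a (s * p.1, p.2) = (s : ℝ) • (a p).comp (.mulLeft s) := by
      ext r
      have hassoc : (r : ℝ) * (s * p.1) = s * r * p.1 := by ring
      simp [hau _ (hΩ p hp s s.2), hau p hp, mul_smul, hassoc]
    rw [← mul_one s, volterraSol_mul, mul_one, ← ha_scale]
  have hy_integral : ∀ p ∈ Ω, y p = 1 + ∫ x in (0 : ℝ)..p.1, y (x, p.2) * u (x, p.2) := by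
    intro p hp
    have hsub := intervalIntegral.smul_integral_comp_mul_right (a := 0) (b := 1)
      (fun x => y (x, p.2) * u (x, p.2)) p.1
    rw [zero_mul, one_mul, ← intervalIntegral.integral_smul] at hsub
    rw [← hsub]
    have hsol := congr($(eq_volterraSol_iff.1 (rfl : volterraSol (a p) = _)) 1)
    refine hsol.trans (congrArg ((1 : 𝔸) + ·) (primitive_apply
      (f := fun s => p.1 • (y (s * p.1, p.2) * u (s * p.1, p.2))) (fun s => ?_) 1))
    rw [ContinuousMap.mul_apply, hau p hp, hy_scale p hp, mul_smul_comm]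
  refine ⟨y, hy, fun p hp => by simpa using hy_integral (0, p) hp, fun p hp => ?_⟩
  have hcont : ContinuousOn (fun x => y (x, p.2) * u (x, p.2)) {x | (x, p.2) ∈ Ω} :=
    (hy.continuousOn.mul hu.continuousOn).comp (f := fun x => (x, p.2)) (by fun_prop) fun _ h => h
  exact hasDerivAt_of_eq_add_integral (hΩo.preimage (by fun_prop)) hcont
    (fun z hz => hy_integral (z, p.2) hz) (hΩ.uIcc_subset hp)

end LinearODE

/-! ### Velocities of curves in a compact linear group -/

section Velocity

section Ad

variable {𝔸 : Type*} [NormedRing 𝔸]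

theorem Ad_add (g : 𝔸ˣ) (X Y : 𝔸) : Ad g (X + Y) = Ad g X + Ad g Y := by
  simp [Ad, mul_add, add_mul]

theorem Ad_neg (g : 𝔸ˣ) (X : 𝔸) : Ad g (-X) = -Ad g X := by simp [Ad]

theorem Ad_smul [NormedAlgebra ℝ 𝔸] (g : 𝔸ˣ) (r : ℝ) (X : 𝔸) : Ad g (r • X) = r • Ad g X := by
  simp [Ad]

theorem Ad_inv_Ad (g : 𝔸ˣ) (X : 𝔸) : Ad g⁻¹ (Ad g X) = X := by
  rw [← Ad_mul, inv_mul_cancel, Ad_one]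

theorem Ad_Ad_inv (g : 𝔸ˣ) (X : 𝔸) : Ad g (Ad g⁻¹ X) = X := by
  rw [← Ad_mul, mul_inv_cancel, Ad_one]

theorem Ad_injective (g : 𝔸ˣ) : Function.Injective (Ad g) :=
  Function.LeftInverse.injective (Ad_inv_Ad g)

end Ad

variable {𝔸 : Type*} [NormedRing 𝔸] [NormedAlgebra ℝ 𝔸]

theorem hasDerivAt_lie {a b : ℝ → 𝔸} {a' b' : 𝔸} {s : ℝ} (ha : HasDerivAt a a' s)
    (hb : HasDerivAt b b' s) : HasDerivAt (fun s => ⁅a s, b s⁆) (⁅a', b s⁆ + ⁅a s, b'⁆) s := by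
  refine ((ha.mul hb).sub (hb.mul ha)).congr_deriv ?_
  simp only [Ring.lie_def]
  abel

theorem hasDerivAt_units_inv [CompleteSpace 𝔸] {c : ℝ → 𝔸ˣ} {c' : 𝔸} {s : ℝ}
    (hc : HasDerivAt (fun s => (c s : 𝔸)) c' s) :
    HasDerivAt (fun s => ((c s)⁻¹ : 𝔸ˣ).val) (-((c s)⁻¹ : 𝔸ˣ).val * c' * ((c s)⁻¹ : 𝔸ˣ).val) s := by
  simpa [Function.comp_def] using
    (hasFDerivAt_ringInverse (𝕜 := ℝ) (c s)).comp_hasDerivAt s hc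

theorem contDiffOn_units_inv [CompleteSpace 𝔸] {X : Type*} [NormedAddCommGroup X]
    [NormedSpace ℝ X] {n : WithTop ℕ∞} {c : X → 𝔸ˣ} {s : Set X}
    (hc : ContDiffOn ℝ n (fun p => (c p : 𝔸)) s) :
    ContDiffOn ℝ n (fun p => ((c p)⁻¹ : 𝔸ˣ).val) s := by
  intro p hp
  simpa [Function.comp_def] using
    (contDiffAt_ringInverse ℝ (n := n) (c p)).comp_contDiffWithinAt p (hc p hp)

variable {G : Subgroup 𝔸ˣ}

/-- The curve `c` in `G` has the left logarithmic derivative `c⁻¹ c' = a` at `s`. -/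
def HasVelocityAt (c : ℝ → G) (a : 𝔸) (s : ℝ) : Prop :=
  HasDerivAt (fun s => ((c s : 𝔸ˣ) : 𝔸)) (((c s : 𝔸ˣ) : 𝔸) * a) s

namespace HasVelocityAt

variable {c d : ℝ → G} {a b : 𝔸} {s : ℝ}

theorem of_hasDerivAt {c' : 𝔸} (hc : HasDerivAt (fun s => ((c s : 𝔸ˣ) : 𝔸)) c' s) :
    HasVelocityAt c ((c s : 𝔸ˣ)⁻¹.val * c') s := by
  simpa [HasVelocityAt] using hc

theorem const (g : G) (s : ℝ) : HasVelocityAt (fun _ => g) 0 s := by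
  simpa [HasVelocityAt] using hasDerivAt_const s ((g : 𝔸ˣ) : 𝔸)

theorem unique (ha : HasVelocityAt c a s) (hb : HasVelocityAt c b s) : a = b :=
  (Units.mul_right_inj _).1 (HasDerivAt.unique ha hb)

theorem congr_of_eventuallyEq (hc : HasVelocityAt c a s) (h : d =ᶠ[nhds s] c) :
    HasVelocityAt d a s := by
  have hcd : (fun s => ((d s : 𝔸ˣ) : 𝔸)) =ᶠ[nhds s] fun s => ((c s : 𝔸ˣ) : 𝔸) :=
    h.fun_comp fun g : G => ((g : 𝔸ˣ) : 𝔸)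
  simpa only [HasVelocityAt, h.self_of_nhds] using HasDerivAt.congr_of_eventuallyEq hc hcd

theorem mul (hc : HasVelocityAt c a s) (hd : HasVelocityAt d b s) :
    HasVelocityAt (fun s => c s * d s) (Ad (d s : 𝔸ˣ)⁻¹ a + b) s := by
  refine (HasDerivAt.mul hc hd).congr_deriv ?_
  simp [Ad, mul_add, mul_assoc]

theorem inv [CompleteSpace 𝔸] (hc : HasVelocityAt c a s) :
    HasVelocityAt (fun s => (c s)⁻¹) (-Ad (c s : 𝔸ˣ) a) s := by
  refine (hasDerivAt_units_inv hc).congr_deriv ?_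
  simp [Ad, mul_assoc]

theorem mul_inv_cancel [CompleteSpace 𝔸] (hc : HasVelocityAt c a s) (hd : HasVelocityAt d a s) :
    HasVelocityAt (fun s => c s * (d s)⁻¹) 0 s := by
  simpa using hc.mul hd.inv

theorem hasDerivAt_Ad [CompleteSpace 𝔸] {X : ℝ → 𝔸} {X' : 𝔸} (hc : HasVelocityAt c a s)
    (hX : HasDerivAt X X' s) :
    HasDerivAt (fun s => Ad (c s : 𝔸ˣ) (X s)) (Ad (c s : 𝔸ˣ) (⁅a, X s⁆ + X')) s := by
  refine ((HasDerivAt.mul hc hX).mul (hasDerivAt_units_inv hc)).congr_deriv ?_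
  simp only [Pi.mul_apply, Ad, Ring.lie_def, mul_add, add_mul, mul_sub, sub_mul, neg_mul, mul_neg,
    mul_assoc, Units.inv_mul_cancel_left]
  abel

theorem mem_lieAlg [FiniteDimensional ℝ 𝔸] (hc : HasVelocityAt c a s) : a ∈ lieAlg G := by
  refine ⟨fun r => (c s : 𝔸ˣ)⁻¹ * c (s + r), fun r => G.mul_mem (G.inv_mem (c s).2) (c _).2,
    by simp, ?_⟩
  have hshift : HasDerivAt (fun r => ((c (s + r) : 𝔸ˣ) : 𝔸)) ((c s : 𝔸ˣ) * a) 0 :=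
    HasDerivAt.comp_const_add s 0 (by simpa [HasVelocityAt] using hc)
  simpa using hshift.const_mul (c s : 𝔸ˣ)⁻¹.val

end HasVelocityAt

end Velocity

theorem completeSpace_of_finiteDimensional {𝔸 : Type*} [NormedRing 𝔸] [NormedAlgebra ℝ 𝔸]
    [FiniteDimensional ℝ 𝔸] : CompleteSpace 𝔸 :=
  FiniteDimensional.complete ℝ 𝔸

attribute [local instance] completeSpace_of_finiteDimensional

section GroupODE

open Set Filter Topology

variable {𝔸 : Type*} [NormedRing 𝔸] {G : Subgroup 𝔸ˣ}

theorem isCompact_units_val_image (hG : IsCompact (G : Set 𝔸ˣ)) :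
    IsCompact (Units.val '' (G : Set 𝔸ˣ)) :=
  hG.image Units.continuous_val

theorem units_val_image_nonempty : (Units.val '' (G : Set 𝔸ˣ)).Nonempty :=
  ⟨_, mem_image_of_mem _ G.one_mem⟩

variable [NormedAlgebra ℝ 𝔸] [FiniteDimensional ℝ 𝔸]

theorem eventually_slope_infDist_lt (hG : IsCompact (G : Set 𝔸ˣ)) {y : ℝ → 𝔸} {a : 𝔸} {x r : ℝ}
    (hy : HasDerivAt y (y x * a) x) (ha : a ∈ lieAlg G)
    (hr : ‖a‖ * Metric.infDist (y x) (Units.val '' (G : Set 𝔸ˣ)) < r) :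
    ∀ᶠ z in 𝓝[>] x, (z - x)⁻¹ * (Metric.infDist (y z) (Units.val '' (G : Set 𝔸ˣ)) -
      Metric.infDist (y x) (Units.val '' (G : Set 𝔸ˣ))) < r := by
  -- With `g` the nearest point of `G` and `c` a curve in `G` with velocity `a`, compare `y` with
  -- the curve `g c` in `G`.
  obtain ⟨_, ⟨g, hg, rfl⟩, hg_dist⟩ :=
    (isCompact_units_val_image hG).exists_infDist_eq_dist units_val_image_nonempty (y x)
  obtain ⟨c, hcG, c_zero, hc⟩ := ha
  have hc_shift : HasDerivAt (fun z => (c (z - x) : 𝔸)) a x :=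
    HasDerivAt.comp_sub_const (f := fun s => (c s : 𝔸)) x x (by rwa [sub_self])
  have hslope : ‖y x * a - (g : 𝔸) * a‖ < r := by
    refine lt_of_le_of_lt ?_ hr
    rw [hg_dist, dist_eq_norm, ← sub_mul, mul_comm]
    exact norm_mul_le _ _
  have hevent := (hy.sub (hc_shift.const_mul (g : 𝔸))).hasDerivWithinAt.limsup_slope_norm_le
    (s := Ioi x) hslope
  filter_upwards [hevent, self_mem_nhdsWithin] with z hz hxz
  have hpos : 0 < z - x := sub_pos.2 hxz
  refine lt_of_le_of_lt ?_ hz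
  rw [Real.norm_of_nonneg hpos.le]
  refine mul_le_mul_of_nonneg_left ?_ (inv_nonneg.2 hpos.le)
  simp only [Pi.sub_apply, sub_self, c_zero, Units.val_one, mul_one]
  rw [hg_dist, ← dist_eq_norm, ← dist_eq_norm]
  gcongr
  exact Metric.infDist_le_dist_of_mem ⟨g * c (z - x), G.mul_mem hg (hcG _), by simp⟩

theorem mem_of_ode_right (hG : IsCompact (G : Set 𝔸ˣ)) {y a : ℝ → 𝔸} {t₀ t₁ : ℝ}
    (h₀ : y t₀ ∈ Units.val '' (G : Set 𝔸ˣ))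
    (hy : ∀ t ∈ Icc t₀ t₁, HasDerivAt y (y t * a t) t) (ha : ContinuousOn a (Icc t₀ t₁))
    (hmem : ∀ t ∈ Icc t₀ t₁, a t ∈ lieAlg G) {t : ℝ} (ht : t ∈ Icc t₀ t₁) :
    y t ∈ Units.val '' (G : Set 𝔸ˣ) := by
  obtain ⟨K, hK⟩ := isCompact_Icc.exists_bound_of_continuousOn ha
  have hdist : ContinuousOn (fun t => Metric.infDist (y t) (Units.val '' (G : Set 𝔸ˣ)))
      (Icc t₀ t₁) :=
    (Metric.continuous_infDist_pt _).comp_continuousOn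
      fun t ht => (hy t ht).continuousAt.continuousWithinAt
  have hgronwall := le_gronwallBound_of_liminf_deriv_right_le (K := K) (ε := 0)
    (f' := fun t => K * Metric.infDist (y t) (Units.val '' (G : Set 𝔸ˣ))) hdist ?_
    (Metric.infDist_zero_of_mem h₀).le (fun x _ => by simp) t ht
  · rw [gronwallBound_ε0_δ0] at hgronwall
    exact ((isCompact_units_val_image hG).isClosed.mem_iff_infDist_zero
      units_val_image_nonempty).2 (le_antisymm hgronwall Metric.infDist_nonneg)
  · intro x hx r hr
    have hx' : x ∈ Icc t₀ t₁ := Ico_subset_Icc_self hx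
    refine (eventually_slope_infDist_lt hG (hy x hx') (hmem x hx') (hr.trans_le' ?_)).frequently
    gcongr
    · exact Metric.infDist_nonneg
    · exact hK x hx'

theorem mem_of_ode (hG : IsCompact (G : Set 𝔸ˣ)) {y a : ℝ → 𝔸} {t₀ t₁ : ℝ}
    (h₀ : y t₀ ∈ Units.val '' (G : Set 𝔸ˣ))
    (hy : ∀ t ∈ uIcc t₀ t₁, HasDerivAt y (y t * a t) t) (ha : ContinuousOn a (uIcc t₀ t₁))
    (hmem : ∀ t ∈ uIcc t₀ t₁, a t ∈ lieAlg G) : y t₁ ∈ Units.val '' (G : Set 𝔸ˣ) := by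
  rcases le_total t₀ t₁ with h | h
  · rw [uIcc_of_le h] at hy ha hmem
    exact mem_of_ode_right hG h₀ hy ha hmem (right_mem_Icc.2 h)
  · rw [uIcc_of_ge h] at hy ha hmem
    have hneg : MapsTo Neg.neg (Icc (-t₀) (-t₁)) (Icc t₁ t₀) := fun s hs =>
      ⟨le_neg.2 hs.2, neg_le.2 hs.1⟩
    have hy_neg : ∀ s ∈ Icc (-t₀) (-t₁),
        HasDerivAt (fun s => y (-s)) (y (-s) * -a (-s)) s := fun s hs => by
      simpa [Function.comp_def] using (hy _ (hneg hs)).scomp s (hasDerivAt_neg s)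
    have ha_neg : ContinuousOn (fun s => -a (-s)) (Icc (-t₀) (-t₁)) :=
      (ha.comp continuous_neg.continuousOn hneg).neg
    simpa using mem_of_ode_right hG (by simpa using h₀) hy_neg ha_neg
      (fun s hs => (lieAlg G).neg_mem (hmem _ (hneg hs))) (right_mem_Icc.2 (neg_le_neg h))

variable {P : Type} [NormedAddCommGroup P] [NormedSpace ℝ P] {Ω : Set (ℝ × P)} {u : ℝ × P → 𝔸}

theorem exists_fundamental_groupODE (hG : IsCompact (G : Set 𝔸ˣ)) (hΩo : IsOpen Ω)
    (hΩ : StarFst Ω) (hu : ContDiffOn ℝ ∞ u Ω) (hmem : ∀ p ∈ Ω, u p ∈ lieAlg G) :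
    ∃ ψ : ℝ × P → G, ContDiffOn ℝ ∞ (fun p => ((ψ p : 𝔸ˣ) : 𝔸)) Ω ∧
      (∀ p, (0, p) ∈ Ω → ψ (0, p) = 1) ∧
      ∀ p ∈ Ω, HasVelocityAt (fun x => ψ (x, p.2)) (u p) p.1 := by
  obtain ⟨y, hy, hy₀, hyd⟩ := exists_linearODE hΩo hΩ hu
  have hyG : ∀ p ∈ Ω, y p ∈ Units.val '' (G : Set 𝔸ˣ) := by
    intro p hp
    have hsub := hΩ.uIcc_subset hp
    refine mem_of_ode hG (y := fun x => y (x, p.2)) (a := fun x => u (x, p.2)) ?_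
      (fun x hx => hyd _ (hsub hx)) ?_ (fun x hx => hmem _ (hsub hx))
    · rw [hy₀ p.2 (hsub left_mem_uIcc)]
      exact ⟨1, G.one_mem, rfl⟩
    · exact hu.continuousOn.comp (f := fun x => (x, p.2)) (by fun_prop) hsub
  choose! g hg using hyG
  classical
  let ψ : ℝ × P → G := fun p => if hp : p ∈ Ω then ⟨g p, (hg p hp).1⟩ else 1
  have hψ : ∀ p ∈ Ω, ((ψ p : 𝔸ˣ) : 𝔸) = y p := fun p hp => by simp [ψ, hp, (hg p hp).2]
  refine ⟨ψ, hy.congr hψ, fun p hp => ?_, fun p hp => ?_⟩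
  · exact Subtype.ext (Units.ext ((hψ _ hp).trans (hy₀ p hp)))
  · have hopen : IsOpen {x | (x, p.2) ∈ Ω} := hΩo.preimage (by fun_prop)
    rw [HasVelocityAt, hψ p hp]
    refine (hyd p hp).congr_of_eventuallyEq ?_
    filter_upwards [hopen.mem_nhds hp] with x hx using hψ _ hx

theorem exists_curve (hG : IsCompact (G : Set 𝔸ˣ)) {I : Set ℝ} (hI : IsOpen I)
    (hIc : I.OrdConnected) {a : ℝ → 𝔸} (ha : ContDiffOn ℝ ∞ a I)
    (hmem : ∀ t ∈ I, a t ∈ lieAlg G) {t₀ : ℝ} (ht₀ : t₀ ∈ I) (g₀ : G) :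
    ∃ k : ℝ → G, k t₀ = g₀ ∧ ContDiffOn ℝ ∞ (fun t => ((k t : 𝔸ˣ) : 𝔸)) I ∧
      ∀ t ∈ I, HasVelocityAt k (a t) t := by
  let shift : ℝ × ℝ → ℝ := fun p => p.1 + t₀
  have hshift : ContDiff ℝ ∞ shift := by fun_prop
  have hΩ : StarFst (shift ⁻¹' I) := by
    intro p hp s hs
    have hconv : (1 - s) • t₀ + s • (p.1 + t₀) ∈ I :=
      hIc.convex ht₀ hp (sub_nonneg.2 hs.2) hs.1 (by ring)
    have hcomb : (1 - s) • t₀ + s • (p.1 + t₀) = s * p.1 + t₀ := by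
      simp only [smul_eq_mul]
      ring
    rwa [hcomb] at hconv
  obtain ⟨ψ, hψ, hψ₀, hψd⟩ := exists_fundamental_groupODE hG (hI.preimage hshift.continuous) hΩ
    (ha.comp hshift.contDiffOn (mapsTo_preimage shift I)) fun p hp => hmem _ hp
  have hin : ∀ t ∈ I, (t - t₀, (0 : ℝ)) ∈ shift ⁻¹' I := fun t ht => by simpa [shift] using ht
  refine ⟨fun t => g₀ * ψ (t - t₀, 0), ?_, ?_, fun t ht => ?_⟩
  · simp [hψ₀ 0 (by simpa [shift] using ht₀)]
  · have hcurve : ContDiffOn ℝ ∞ (fun t => ((ψ (t - t₀, 0) : 𝔸ˣ) : 𝔸)) I :=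
      hψ.comp (by fun_prop : ContDiff ℝ ∞ fun t : ℝ => (t - t₀, (0 : ℝ))).contDiffOn hin
    exact contDiffOn_const.mul hcurve
  · have hvel : HasVelocityAt (fun t => ψ (t - t₀, 0)) (a t) t := by
      have := hψd _ (hin t ht)
      simp only [Function.comp_apply, shift, sub_add_cancel] at this
      exact HasDerivAt.comp_sub_const t t₀ this
    simpa [Ad] using (HasVelocityAt.const g₀ t).mul hvel

theorem exists_family (hG : IsCompact (G : Set 𝔸ˣ)) {I : Set ℝ} (hI : IsOpen I)
    {u : ℝ → ℝ → 𝔸} (hu : Smooth I u) (hmem : ∀ x, ∀ t ∈ I, u x t ∈ lieAlg G) {φ : ℝ → G}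
    (hφ : ContDiffOn ℝ ∞ (fun t => ((φ t : 𝔸ˣ) : 𝔸)) I) :
    ∃ ψ : ℝ → ℝ → G, Smooth I (fun x t => ((ψ x t : 𝔸ˣ) : 𝔸)) ∧ (∀ t ∈ I, ψ 0 t = φ t) ∧
      ∀ x, ∀ t ∈ I, HasVelocityAt (fun x => ψ x t) (u x t) x := by
  obtain ⟨ψ, hψ, hψ₀, hψd⟩ := exists_fundamental_groupODE hG (isOpen_univ.prod hI)
    (fun p hp s _ => ⟨mem_univ _, hp.2⟩) hu fun p hp => hmem _ _ hp.2
  refine ⟨fun x t => φ t * ψ (x, t), ?_, fun t ht => ?_, fun x t ht => ?_⟩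
  · exact ContDiffOn.mul (hφ.comp contDiff_snd.contDiffOn fun p hp => hp.2) hψ
  · simp [hψ₀ t ⟨mem_univ _, ht⟩]
  · simpa [Ad] using (HasVelocityAt.const (φ t) x).mul (hψd (x, t) ⟨mem_univ _, ht⟩)

end GroupODE

/-! ### Smooth functions of `(x, t)` -/

section TwoVariable

open Set Filter Topology

variable {V : Type*} [NormedAddCommGroup V] [NormedSpace ℝ V]

theorem mem_submodule_of_hasDerivAt [FiniteDimensional ℝ V] (S : Submodule ℝ V) {c : ℝ → V}
    {c' : V} {s : ℝ} (hc : HasDerivAt c c' s) (hS : ∀ᶠ r in 𝓝 s, c r ∈ S) : c' ∈ S := by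
  refine S.closed_of_finiteDimensional.mem_of_tendsto (hasDerivAt_iff_tendsto_slope.1 hc) ?_
  filter_upwards [hS.filter_mono nhdsWithin_le_nhds] with r hr
  exact S.smul_mem _ (S.sub_mem hr hS.self_of_nhds)

theorem eq_of_hasDerivAt_zero {c : ℝ → V} {J : Set ℝ} (hJ : IsOpen J) (hJc : J.OrdConnected)
    (h : ∀ s ∈ J, HasDerivAt c 0 s) {s r : ℝ} (hs : s ∈ J) (hr : r ∈ J) : c s = c r :=
  hJ.is_const_of_deriv_eq_zero hJc.isPreconnected
    (fun z hz => (h z hz).differentiableAt.differentiableWithinAt) (fun z hz => (h z hz).deriv)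
    hs hr

theorem hasDerivAt_fst_of_hasFDerivAt {F : ℝ × ℝ → V} {F' : ℝ × ℝ →L[ℝ] V} {x t : ℝ}
    (hF : HasFDerivAt F F' (x, t)) : HasDerivAt (fun y => F (y, t)) (F' (1, 0)) x :=
  hF.comp_hasDerivAt (f := fun y : ℝ => (y, t)) x
    ((hasDerivAt_id x).prodMk (hasDerivAt_const x t))

theorem hasDerivAt_snd_of_hasFDerivAt {F : ℝ × ℝ → V} {F' : ℝ × ℝ →L[ℝ] V} {x t : ℝ}
    (hF : HasFDerivAt F F' (x, t)) : HasDerivAt (fun s => F (x, s)) (F' (0, 1)) t :=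
  hF.comp_hasDerivAt (f := fun s : ℝ => (x, s)) t
    ((hasDerivAt_const t x).prodMk (hasDerivAt_id t))

variable {I : Set ℝ} {f g : ℝ → ℝ → V}

theorem isOpen_scaleTime (hI : IsOpen I) (c : ℝ) : IsOpen (scaleTime c I) :=
  hI.preimage (by fun_prop)

theorem dx_congr (h : ∀ x, ∀ t ∈ I, f x t = g x t) (x : ℝ) {t : ℝ} (ht : t ∈ I) :
    dx f x t = dx g x t :=
  congrArg (deriv · x) (funext fun y => h y t ht)

theorem dt_congr (hI : IsOpen I) (h : ∀ x, ∀ t ∈ I, f x t = g x t) (x : ℝ) {t : ℝ} (ht : t ∈ I) :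
    dt f x t = dt g x t :=
  EventuallyEq.deriv_eq (by filter_upwards [hI.mem_nhds ht] with s hs using h x s hs)

theorem dt_comp_mul (f : ℝ → ℝ → V) (c x t : ℝ) :
    dt (fun x t => f x (c * t)) x t = c • dt f x (c * t) :=
  deriv_comp_mul_left c (fun s => f x s) t

theorem dx_translate (f : ℝ → ℝ → V) (L x t : ℝ) :
    dx (fun x t => f (x + L) t) x t = dx f (x + L) t :=
  deriv_comp_add_const (fun x => f x t) L x

theorem div_mem_scaleTime_iff {c : ℝ} (hc : c ≠ 0) {t : ℝ} : t / c ∈ scaleTime c I ↔ t ∈ I := by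
  rw [scaleTime, mem_ofPred_eq, mul_div_cancel₀ t hc]

theorem scaleTime_inv_scaleTime {c : ℝ} (hc : c ≠ 0) (I : Set ℝ) :
    scaleTime c⁻¹ (scaleTime c I) = I := by
  ext t
  rw [scaleTime, scaleTime, mem_ofPred_eq, mem_ofPred_eq, mul_inv_cancel_left₀ hc]

theorem forall_scaleTime {c : ℝ} (hc : c ≠ 0) {P : ℝ → ℝ → Prop} :
    (∀ x, ∀ t ∈ scaleTime c I, P x (c * t)) ↔ ∀ x, ∀ t ∈ I, P x t := by
  refine forall_congr' fun x => ⟨fun h t ht => ?_, fun h t ht => h _ ht⟩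
  simpa only [mul_div_cancel₀ t hc] using h (t / c) ((div_mem_scaleTime_iff hc).2 ht)

theorem smooth_const (v : V) : Smooth I fun _ _ => v := contDiffOn_const

theorem smooth_of_contDiffOn {k : ℝ → V} (hk : ContDiffOn ℝ ∞ k I) : Smooth I fun _ t => k t :=
  ContDiffOn.comp (s := univ ×ˢ I) hk contDiff_snd.contDiffOn fun _ hp => hp.2

namespace Smooth

protected theorem congr (hf : Smooth I f) (h : ∀ x, ∀ t ∈ I, g x t = f x t) : Smooth I g :=
  ContDiffOn.congr hf fun p hp => h p.1 p.2 hp.2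

protected theorem add (hf : Smooth I f) (hg : Smooth I g) : Smooth I fun x t => f x t + g x t :=
  ContDiffOn.add hf hg

protected theorem sub (hf : Smooth I f) (hg : Smooth I g) : Smooth I fun x t => f x t - g x t :=
  ContDiffOn.sub hf hg

protected theorem neg (hf : Smooth I f) : Smooth I fun x t => -f x t := ContDiffOn.neg hf

protected theorem const_smul (hf : Smooth I f) (r : ℝ) : Smooth I fun x t => r • f x t :=
  ContDiffOn.const_smul r hf

theorem contDiffOn_slice (hf : Smooth I f) (x : ℝ) : ContDiffOn ℝ ∞ (fun t => f x t) I :=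
  ContDiffOn.comp (s := I) (g := fun p : ℝ × ℝ => f p.1 p.2) hf
    (by fun_prop : ContDiff ℝ ∞ fun t : ℝ => (x, t)).contDiffOn fun _ ht => ⟨mem_univ _, ht⟩

protected theorem scaleTime (hf : Smooth I f) (c : ℝ) :
    Smooth (scaleTime c I) fun x t => f x (c * t) :=
  ContDiffOn.comp (s := univ ×ˢ scaleTime c I) hf
    (by fun_prop : ContDiff ℝ ∞ fun p : ℝ × ℝ => (p.1, c * p.2)).contDiffOn
    fun _ hp => ⟨mem_univ _, hp.2⟩

theorem translate (hf : Smooth I f) (L : ℝ) : Smooth I fun x t => f (x + L) t :=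
  ContDiffOn.comp (s := univ ×ˢ I) hf
    (by fun_prop : ContDiff ℝ ∞ fun p : ℝ × ℝ => (p.1 + L, p.2)).contDiffOn
    fun _ hp => ⟨mem_univ _, hp.2⟩

variable (hf : Smooth I f) (hI : IsOpen I)

include hf hI

theorem contDiffAt (x : ℝ) {t : ℝ} (ht : t ∈ I) :
    ContDiffAt ℝ ∞ (fun p : ℝ × ℝ => f p.1 p.2) (x, t) :=
  ContDiffOn.contDiffAt hf ((isOpen_univ.prod hI).mem_nhds ⟨mem_univ x, ht⟩)

theorem hasFDerivAt (x : ℝ) {t : ℝ} (ht : t ∈ I) :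
    HasFDerivAt (fun p : ℝ × ℝ => f p.1 p.2) (fderiv ℝ (fun p : ℝ × ℝ => f p.1 p.2) (x, t))
      (x, t) :=
  ((hf.contDiffAt hI x ht).differentiableAt (by simp)).hasFDerivAt

theorem dx_eq_fderiv (x : ℝ) {t : ℝ} (ht : t ∈ I) :
    dx f x t = fderiv ℝ (fun p : ℝ × ℝ => f p.1 p.2) (x, t) (1, 0) :=
  (hasDerivAt_fst_of_hasFDerivAt (hf.hasFDerivAt hI x ht)).deriv

theorem dt_eq_fderiv (x : ℝ) {t : ℝ} (ht : t ∈ I) :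
    dt f x t = fderiv ℝ (fun p : ℝ × ℝ => f p.1 p.2) (x, t) (0, 1) :=
  (hasDerivAt_snd_of_hasFDerivAt (hf.hasFDerivAt hI x ht)).deriv

theorem hasDerivAt_dx (x : ℝ) {t : ℝ} (ht : t ∈ I) : HasDerivAt (fun y => f y t) (dx f x t) x :=
  (hasDerivAt_fst_of_hasFDerivAt (hf.hasFDerivAt hI x ht)).differentiableAt.hasDerivAt

theorem hasDerivAt_dt (x : ℝ) {t : ℝ} (ht : t ∈ I) : HasDerivAt (fun s => f x s) (dt f x t) t :=
  (hasDerivAt_snd_of_hasFDerivAt (hf.hasFDerivAt hI x ht)).differentiableAt.hasDerivAt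

theorem contDiffOn_fderiv : ContDiffOn ℝ ∞ (fderiv ℝ fun p : ℝ × ℝ => f p.1 p.2) (univ ×ˢ I) :=
  hf.fderiv_of_isOpen (isOpen_univ.prod hI) (by simp)

protected theorem dx : Smooth I (dx f) :=
  ((hf.contDiffOn_fderiv hI).clm_apply contDiffOn_const).congr
    fun p hp => hf.dx_eq_fderiv hI p.1 hp.2

protected theorem dt : Smooth I (dt f) :=
  ((hf.contDiffOn_fderiv hI).clm_apply contDiffOn_const).congr
    fun p hp => hf.dt_eq_fderiv hI p.1 hp.2

theorem dx_dt_comm (x : ℝ) {t : ℝ} (ht : t ∈ I) : dx (dt f) x t = dt (dx f) x t := by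
  set F : ℝ × ℝ → V := fun p => f p.1 p.2
  have hF' : HasFDerivAt (fderiv ℝ F) (fderiv ℝ (fderiv ℝ F) (x, t)) (x, t) :=
    (((hf.contDiffOn_fderiv hI).contDiffAt ((isOpen_univ.prod hI).mem_nhds
      ⟨mem_univ x, ht⟩)).differentiableAt (by simp)).hasFDerivAt
  have hsymm : IsSymmSndFDerivAt ℝ F (x, t) :=
    (hf.contDiffAt hI x ht).isSymmSndFDerivAt
      (by simpa using WithTop.coe_le_coe.2 (le_top : (2 : ℕ∞) ≤ ⊤))
  calc dx (dt f) x t = dx (fun x t => fderiv ℝ F (x, t) (0, 1)) x t :=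
        dx_congr (fun x _ => hf.dt_eq_fderiv hI x) x ht
    _ = fderiv ℝ (fderiv ℝ F) (x, t) (1, 0) (0, 1) :=
        ((hasDerivAt_fst_of_hasFDerivAt hF').clm_apply (hasDerivAt_const x _)).deriv.trans
          (by simp)
    _ = fderiv ℝ (fderiv ℝ F) (x, t) (0, 1) (1, 0) := hsymm.eq _ _
    _ = dt (fun x t => fderiv ℝ F (x, t) (1, 0)) x t :=
        (((hasDerivAt_snd_of_hasFDerivAt hF').clm_apply (hasDerivAt_const t _)).deriv.trans
          (by simp)).symm
    _ = dt (dx f) x t := (dt_congr hI (fun x _ => hf.dx_eq_fderiv hI x) x ht).symm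

end Smooth

end TwoVariable

section SmoothAlgebra

variable {𝔸 : Type*} [NormedRing 𝔸] [NormedAlgebra ℝ 𝔸] {I : Set ℝ} {f g : ℝ → ℝ → 𝔸}

namespace Smooth

protected theorem mul (hf : Smooth I f) (hg : Smooth I g) : Smooth I fun x t => f x t * g x t :=
  ContDiffOn.mul hf hg

protected theorem lie (hf : Smooth I f) (hg : Smooth I g) : Smooth I fun x t => ⁅f x t, g x t⁆ := by
  simp only [Ring.lie_def]
  exact (hf.mul hg).sub (hg.mul hf)

protected theorem units_inv [CompleteSpace 𝔸] {c : ℝ → ℝ → 𝔸ˣ}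
    (hc : Smooth I fun x t => (c x t : 𝔸)) : Smooth I fun x t => ((c x t)⁻¹ : 𝔸ˣ).val :=
  contDiffOn_units_inv (c := fun p : ℝ × ℝ => c p.1 p.2) hc

protected theorem Ad [CompleteSpace 𝔸] {c : ℝ → ℝ → 𝔸ˣ} (hc : Smooth I fun x t => (c x t : 𝔸))
    (hf : Smooth I f) : Smooth I fun x t => Ad (c x t) (f x t) :=
  (hc.mul hf).mul hc.units_inv

end Smooth

theorem dx_Ad (hI : IsOpen I) (hf : Smooth I f) (g : 𝔸ˣ) (x : ℝ) {t : ℝ} (ht : t ∈ I) :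
    dx (fun x t => Ad g (f x t)) x t = Ad g (dx f x t) :=
  (((hf.hasDerivAt_dx hI x ht).const_mul _).mul_const _).deriv

theorem dt_Ad (hI : IsOpen I) (hf : Smooth I f) (g : 𝔸ˣ) (x : ℝ) {t : ℝ} (ht : t ∈ I) :
    dt (fun x t => Ad g (f x t)) x t = Ad g (dt f x t) :=
  (((hf.hasDerivAt_dt hI x ht).const_mul _).mul_const _).deriv

end SmoothAlgebra

/-! ### Hermitian symmetric structures and the adjoint orbit -/

section Algebra

open Filter

variable {𝔸 : Type*} [NormedRing 𝔸] [NormedAlgebra ℝ 𝔸] [FiniteDimensional ℝ 𝔸]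
variable {G : Subgroup 𝔸ˣ}

/-- `Ad(g)` as an automorphism of the Lie algebra. -/
def adEquiv (g : G) : lieAlg G ≃ₗ⁅ℝ⁆ lieAlg G where
  toFun X := ⟨Ad (g : 𝔸ˣ) X, Ad_mem g.2 X.2⟩
  map_add' _ _ := Subtype.ext (Ad_add _ _ _)
  map_smul' _ _ := Subtype.ext (Ad_smul _ _ _)
  map_lie' := Subtype.ext (Ad_lie _ _ _)
  invFun X := ⟨Ad (g : 𝔸ˣ)⁻¹ X, Ad_mem (G.inv_mem g.2) X.2⟩
  left_inv _ := Subtype.ext (Ad_inv_Ad _ _)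
  right_inv _ := Subtype.ext (Ad_Ad_inv _ _)

theorem eq_zero_of_central (hss : LieAlgebra.IsSemisimple ℝ (lieAlg G)) {Z : 𝔸}
    (hZ : Z ∈ lieAlg G) (h : ∀ X ∈ lieAlg G, ⁅Z, X⁆ = 0) : Z = 0 := by
  have hker : (⟨Z, hZ⟩ : lieAlg G) ∈ (LieAlgebra.ad ℝ (lieAlg G)).ker := by
    rw [LieHom.mem_ker]
    ext X
    exact h X X.2
  rw [LieAlgebra.ad_ker_eq_bot_of_hasTrivialRadical, LieSubmodule.mem_bot] at hker
  exact congrArg Subtype.val hker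

namespace HermSymm

variable (D : HermSymm G)

theorem mem_lieAlg_iff {X : 𝔸} : X ∈ lieAlg G ↔ ∃ Y ∈ D.𝔪, ∃ Z ∈ D.𝔥, Y + Z = X := by
  rw [← Submodule.mem_sup, D.sup_eq]
  rfl

theorem mem_lieAlg_of_mem_m {X : 𝔸} (hX : X ∈ D.𝔪) : X ∈ lieAlg G :=
  D.mem_lieAlg_iff.2 ⟨X, hX, 0, D.𝔥.zero_mem, add_zero X⟩

theorem mem_lieAlg_of_mem_h {X : 𝔸} (hX : X ∈ D.𝔥) : X ∈ lieAlg G :=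
  D.mem_lieAlg_iff.2 ⟨0, D.𝔪.zero_mem, X, hX, zero_add X⟩

theorem eq_zero_of_mem_of_mem {X : 𝔸} (hm : X ∈ D.𝔪) (hh : X ∈ D.𝔥) : X = 0 :=
  Submodule.disjoint_def.1 D.disjoint X hm hh

theorem A_lie_h {X : 𝔸} (hX : X ∈ D.𝔥) : ⁅D.A, X⁆ = 0 :=
  (D.centralizer X (D.mem_lieAlg_of_mem_h hX)).2 hX

theorem A_lie_m {X : 𝔸} (hX : X ∈ D.𝔪) : ⁅D.A, X⁆ ∈ D.𝔪 :=
  D.lie_hm _ D.A_mem _ hX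

theorem A_lie_mem {X : 𝔸} (hX : X ∈ lieAlg G) : ⁅D.A, X⁆ ∈ D.𝔪 := by
  obtain ⟨Y, hY, Z, hZ, rfl⟩ := D.mem_lieAlg_iff.1 hX
  rw [lie_add, D.A_lie_h hZ, add_zero]
  exact D.A_lie_m hY

theorem mem_m_of_sq {X : 𝔸} (hX : X ∈ lieAlg G) (h : ⁅D.A, ⁅D.A, X⁆⁆ = -X) : X ∈ D.𝔪 :=
  (Submodule.neg_mem_iff _).1 (h ▸ D.A_lie_m (D.A_lie_mem hX))

theorem lie_mh {X Y : 𝔸} (hX : X ∈ D.𝔪) (hY : Y ∈ D.𝔥) : ⁅X, Y⁆ ∈ D.𝔪 := by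
  rw [← lie_skew]
  exact D.𝔪.neg_mem (D.lie_hm _ hY _ hX)

theorem lie_A_comm {X Y : 𝔸} (hX : X ∈ D.𝔪) (hY : Y ∈ D.𝔪) : ⁅X, ⁅D.A, Y⁆⁆ = ⁅Y, ⁅D.A, X⁆⁆ := by
  have h := D.A_lie_h (D.lie_mm _ hX _ hY)
  rw [leibniz_lie] at h
  rw [eq_neg_of_add_eq_zero_right h, lie_skew]

theorem Ad_A {k : G} (hk : k ∈ D.H) : Ad (k : 𝔸ˣ) D.A = D.A := hk

theorem Ad_A_lie {k : G} (hk : k ∈ D.H) (X : 𝔸) : Ad (k : 𝔸ˣ) ⁅D.A, X⁆ = ⁅D.A, Ad (k : 𝔸ˣ) X⁆ := by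
  rw [Ad_lie, D.Ad_A hk]

theorem Ad_mem_m {k : G} (hk : k ∈ D.H) {X : 𝔸} (hX : X ∈ D.𝔪) : Ad (k : 𝔸ˣ) X ∈ D.𝔪 := by
  refine D.mem_m_of_sq (Ad_mem k.2 (D.mem_lieAlg_of_mem_m hX)) ?_
  rw [← D.Ad_A_lie hk, ← D.Ad_A_lie hk, D.sq_eq X hX, Ad_neg]

theorem Ad_inv_mem_m {k : G} (hk : k ∈ D.H) {X : 𝔸} (hX : X ∈ D.𝔪) :
    Ad (k : 𝔸ˣ)⁻¹ X ∈ D.𝔪 :=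
  D.Ad_mem_m (D.H.inv_mem hk) hX

-- `-ad(A)²` is a projection onto `𝔪`, so its trace is the dimension of `𝔪`.
theorem normSqA_eq_finrank : D.normSqA = Module.finrank ℝ D.𝔪 := by
  let L := lieAlg G
  let p : Submodule ℝ L := D.𝔪.comap L.toSubmodule.subtype
  let ad : L →ₗ[ℝ] L := LieAlgebra.ad ℝ L ⟨D.A, D.A_mem_lieAlg⟩
  have hproj : LinearMap.IsProj p (-(ad ∘ₗ ad)) :=
    { map_mem := fun X => D.𝔪.neg_mem (D.A_lie_m (D.A_lie_mem X.2))
      map_id := fun X hX => Subtype.ext <| by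
        change -⁅D.A, ⁅D.A, (X : 𝔸)⁆⁆ = X
        rw [D.sq_eq X hX, neg_neg] }
  have hp : p ≃ₗ[ℝ] D.𝔪 :=
    Submodule.comapSubtypeEquivOfLe fun _ hX => D.mem_lieAlg_of_mem_m hX
  rw [← hp.finrank_eq, ← hproj.trace, map_neg]
  rfl

theorem normSqA_pos (hm : D.𝔪 ≠ ⊥) : 0 < D.normSqA := by
  have : Nontrivial D.𝔪 := Submodule.nontrivial_iff_ne_bot.2 hm
  rw [D.normSqA_eq_finrank]
  exact_mod_cast Module.finrank_pos (R := ℝ) (M := D.𝔪)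

theorem emb_mk (g : G) : D.emb (QuotientGroup.mk g) = Ad (g : 𝔸ˣ) D.A := rfl

theorem emb_smul (g : G) (p : D.M) : D.emb (g • p) = Ad (g : 𝔸ˣ) (D.emb p) := by
  obtain ⟨h, rfl⟩ := QuotientGroup.mk_surjective p
  exact Ad_mul (g : 𝔸ˣ) (h : 𝔸ˣ) D.A

theorem emb_mem (p : D.M) : D.emb p ∈ lieAlg G := by
  obtain ⟨g, rfl⟩ := QuotientGroup.mk_surjective p
  exact Ad_mem g.2 D.A_mem_lieAlg

/- The condition is the derivative at `A`, in the direction `Y`, of the identity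
`ad(P)³ = -ad(P)` satisfied by the points `P` of the orbit. -/
theorem mem_m_of_linearized_cube (hss : LieAlgebra.IsSemisimple ℝ (lieAlg G)) {Y : 𝔸}
    (hY : Y ∈ lieAlg G)
    (h : ∀ X ∈ lieAlg G, ⁅Y, ⁅D.A, ⁅D.A, X⁆⁆⁆ + (⁅D.A, ⁅Y, ⁅D.A, X⁆⁆⁆ + ⁅D.A, ⁅D.A, ⁅Y, X⁆⁆⁆) =
      -⁅Y, X⁆) : Y ∈ D.𝔪 := by
  obtain ⟨Y, hYm, Z, hZ, rfl⟩ := D.mem_lieAlg_iff.1 hY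
  have hcomm (X : 𝔸) : ⁅D.A, ⁅Z, X⁆⁆ = ⁅Z, ⁅D.A, X⁆⁆ := by
    rw [leibniz_lie D.A Z X, D.A_lie_h hZ, zero_lie, zero_add]
  have hZm : ∀ X ∈ D.𝔪, ⁅Z, X⁆ = 0 := by
    intro X hX
    have hX' := h X (D.mem_lieAlg_of_mem_m hX)
    simp only [add_lie, lie_add, D.sq_eq X hX, D.A_lie_h (D.lie_mm _ hYm _ (D.A_lie_m hX)),
      D.A_lie_h (D.lie_mm _ hYm _ hX), hcomm, lie_neg, lie_zero] at hX'
    have htwo : (2 : ℝ) • ⁅Z, X⁆ = 0 := by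
      rw [two_smul, ← neg_eq_zero, ← sub_eq_zero.2 hX']
      abel
    exact (smul_eq_zero.1 htwo).resolve_left two_ne_zero
  have hZh : ∀ X ∈ D.𝔥, ⁅Z, X⁆ = 0 := by
    intro X hX
    have hX' := h X (D.mem_lieAlg_of_mem_h hX)
    simpa only [add_lie, lie_add, D.A_lie_h hX, lie_zero, D.A_lie_h (D.lie_hh _ hZ _ hX),
      D.sq_eq _ (D.lie_mh hYm hX), zero_add, add_zero, neg_add, left_eq_add,
      neg_eq_zero] using hX'
  have hZ0 : Z = 0 := by
    refine eq_zero_of_central hss (D.mem_lieAlg_of_mem_h hZ) fun X hX => ?_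
    obtain ⟨X, hXm, W, hW, rfl⟩ := D.mem_lieAlg_iff.1 hX
    rw [lie_add, hZm X hXm, hZh W hW, add_zero]
  rwa [hZ0, add_zero]

theorem deriv_emb_mem_m (hss : LieAlgebra.IsSemisimple ℝ (lieAlg G)) {p : ℝ → D.M} {p' : 𝔸}
    {s : ℝ} (hp : HasDerivAt (fun r => D.emb (p r)) p' s) (hA : D.emb (p s) = D.A) :
    p' ∈ D.𝔪 := by
  have hmem : p' ∈ lieAlg G :=
    mem_submodule_of_hasDerivAt (lieAlg G).toSubmodule hp (.of_forall fun r => D.emb_mem (p r))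
  refine D.mem_m_of_linearized_cube hss hmem fun X hX => ?_
  have hlie := hasDerivAt_lie hp (hasDerivAt_const s X)
  have hcube := hasDerivAt_lie hp (hasDerivAt_lie hp hlie)
  have heq : (fun r => ⁅D.emb (p r), ⁅D.emb (p r), ⁅D.emb (p r), X⁆⁆⁆) =
      fun r => -⁅D.emb (p r), X⁆ := funext fun r => D.Jmap_cube (p r) hX
  have hderiv := (heq ▸ hcube).unique hlie.neg
  simp only [hA, lie_zero, add_zero, lie_add] at hderiv
  exact hderiv

theorem lie_emb_lie_emb_deriv (hss : LieAlgebra.IsSemisimple ℝ (lieAlg G)) {p : ℝ → D.M} {p' : 𝔸}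
    {s : ℝ} (hp : HasDerivAt (fun r => D.emb (p r)) p' s) :
    ⁅D.emb (p s), ⁅D.emb (p s), p'⁆⁆ = -p' := by
  obtain ⟨g, hg⟩ := QuotientGroup.mk_surjective (p s)
  have hpg : HasDerivAt (fun r => D.emb (g⁻¹ • p r)) (Ad (g : 𝔸ˣ)⁻¹ p') s := by
    simp only [emb_smul]
    exact (hp.const_mul _).mul_const _
  have hA : D.emb (g⁻¹ • p s) = D.A := by
    rw [← hg, emb_smul]
    exact Ad_inv_Ad _ _
  refine Ad_injective (g : 𝔸ˣ)⁻¹ ?_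
  have hemb : Ad (g : 𝔸ˣ)⁻¹ (D.emb (p s)) = D.A := (D.emb_smul g⁻¹ (p s)).symm.trans hA
  rw [Ad_lie, Ad_lie, hemb, D.sq_eq _ (D.deriv_emb_mem_m hss hpg hA), Ad_neg]

end HermSymm

end Algebra

/-! ### Frames -/

section Frames

open Set Filter Topology

variable {𝔸 : Type*} [NormedRing 𝔸] [NormedAlgebra ℝ 𝔸] {G : Subgroup 𝔸ˣ} {I : Set ℝ}
  {ψ ψ' : ℝ → ℝ → G}

theorem contDiffOn_mul_coe {X : Type*} [NormedAddCommGroup X] [NormedSpace ℝ X] {c d : X → G}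
    {s : Set X} (hc : ContDiffOn ℝ ∞ (fun p => ((c p : 𝔸ˣ) : 𝔸)) s)
    (hd : ContDiffOn ℝ ∞ (fun p => ((d p : 𝔸ˣ) : 𝔸)) s) :
    ContDiffOn ℝ ∞ (fun p => (((c p * d p : G) : 𝔸ˣ) : 𝔸)) s :=
  hc.mul hd

theorem exists_hasVelocityAt (hI : IsOpen I) {k : ℝ → G}
    (hk : ContDiffOn ℝ ∞ (fun t => ((k t : 𝔸ˣ) : 𝔸)) I) {t : ℝ} (ht : t ∈ I) :
    ∃ a, HasVelocityAt k a t :=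
  ⟨_, .of_hasDerivAt
    ((hk.contDiffAt (hI.mem_nhds ht)).differentiableAt (by simp)).hasDerivAt⟩

theorem eq_of_hasVelocityAt_zero (hI : IsOpen I) (hIc : I.OrdConnected) {k : ℝ → G}
    (hk : ∀ t ∈ I, HasVelocityAt k 0 t) {s r : ℝ} (hs : s ∈ I) (hr : r ∈ I) : k s = k r := by
  refine Subtype.ext (Units.ext (eq_of_hasDerivAt_zero
    (c := fun t => ((k t : 𝔸ˣ) : 𝔸)) hI hIc (fun t ht => ?_) hs hr))
  simpa only [HasVelocityAt, mul_zero] using hk t ht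

theorem hasVelocityAt_hasimoto (hI : IsOpen I) (hψ : Smooth I fun x t => ((ψ x t : 𝔸ˣ) : 𝔸))
    (x : ℝ) {t : ℝ} (ht : t ∈ I) : HasVelocityAt (fun y => ψ y t) (hasimoto ψ x t) x :=
  .of_hasDerivAt (hψ.hasDerivAt_dx hI x ht)

theorem hasVelocityAt_frameVel (hI : IsOpen I) (hψ : Smooth I fun x t => ((ψ x t : 𝔸ˣ) : 𝔸))
    (x : ℝ) {t : ℝ} (ht : t ∈ I) : HasVelocityAt (fun s => ψ x s) (frameVel ψ x t) t :=
  .of_hasDerivAt (hψ.hasDerivAt_dt hI x ht)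

theorem hasimoto_eq {x t : ℝ} {a : 𝔸} (h : HasVelocityAt (fun y => ψ y t) a x) :
    hasimoto ψ x t = a :=
  (HasVelocityAt.of_hasDerivAt (HasDerivAt.differentiableAt h).hasDerivAt).unique h

theorem frameVel_eq {x t : ℝ} {a : 𝔸} (h : HasVelocityAt (fun s => ψ x s) a t) :
    frameVel ψ x t = a :=
  (HasVelocityAt.of_hasDerivAt (HasDerivAt.differentiableAt h).hasDerivAt).unique h

theorem hasimoto_congr (h : ∀ x, ∀ t ∈ I, ψ' x t = ψ x t) (x : ℝ) {t : ℝ} (ht : t ∈ I) :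
    hasimoto ψ' x t = hasimoto ψ x t := by
  rw [hasimoto, hasimoto, h x t ht,
    dx_congr (g := fun x t => ((ψ x t : 𝔸ˣ) : 𝔸)) (fun x t ht => by rw [h x t ht]) x ht]

theorem frameVel_congr (hI : IsOpen I) (h : ∀ x, ∀ t ∈ I, ψ' x t = ψ x t) (x : ℝ) {t : ℝ}
    (ht : t ∈ I) : frameVel ψ' x t = frameVel ψ x t := by
  rw [frameVel, frameVel, h x t ht,
    dt_congr (g := fun x t => ((ψ x t : 𝔸ˣ) : 𝔸)) hI (fun x t ht => by rw [h x t ht]) x ht]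

theorem hasimoto_mul_right (hI : IsOpen I) (hψ : Smooth I fun x t => ((ψ x t : 𝔸ˣ) : 𝔸))
    (k : ℝ → G) (x : ℝ) {t : ℝ} (ht : t ∈ I) :
    hasimoto (fun x t => ψ x t * k t) x t = Ad (k t : 𝔸ˣ)⁻¹ (hasimoto ψ x t) := by
  rw [← add_zero (Ad _ _)]
  exact hasimoto_eq ((hasVelocityAt_hasimoto hI hψ x ht).mul (.const (k t) x))

theorem frameVel_mul_right (hI : IsOpen I) (hψ : Smooth I fun x t => ((ψ x t : 𝔸ˣ) : 𝔸))
    {k : ℝ → G} {a : 𝔸} (x : ℝ) {t : ℝ} (ht : t ∈ I) (hk : HasVelocityAt k a t) :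
    frameVel (fun x t => ψ x t * k t) x t = Ad (k t : 𝔸ˣ)⁻¹ (frameVel ψ x t) + a :=
  frameVel_eq ((hasVelocityAt_frameVel hI hψ x ht).mul hk)

theorem hasimoto_mul_left (hI : IsOpen I) (hψ : Smooth I fun x t => ((ψ x t : 𝔸ˣ) : 𝔸))
    (g : ℝ → G) (x : ℝ) {t : ℝ} (ht : t ∈ I) :
    hasimoto (fun x t => g t * ψ x t) x t = hasimoto ψ x t := by
  simpa [Ad] using hasimoto_eq (ψ := fun x t => g t * ψ x t)
    ((HasVelocityAt.const (g t) x).mul (hasVelocityAt_hasimoto hI hψ x ht))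

theorem frameVel_mul_left (hI : IsOpen I) (hψ : Smooth I fun x t => ((ψ x t : 𝔸ˣ) : 𝔸))
    {g : ℝ → G} {a : 𝔸} (x : ℝ) {t : ℝ} (ht : t ∈ I) (hg : HasVelocityAt g a t) :
    frameVel (fun x t => g t * ψ x t) x t = Ad (ψ x t : 𝔸ˣ)⁻¹ a + frameVel ψ x t :=
  frameVel_eq (hg.mul (hasVelocityAt_frameVel hI hψ x ht))

theorem hasimoto_translate (ψ : ℝ → ℝ → G) (L x t : ℝ) :
    hasimoto (fun x t => ψ (x + L) t) x t = hasimoto ψ (x + L) t := by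
  rw [hasimoto, hasimoto, dx_translate (fun x t => ((ψ x t : 𝔸ˣ) : 𝔸))]

variable [FiniteDimensional ℝ 𝔸]

theorem contDiffOn_inv_coe {X : Type*} [NormedAddCommGroup X] [NormedSpace ℝ X] {c : X → G}
    {s : Set X} (hc : ContDiffOn ℝ ∞ (fun p => ((c p : 𝔸ˣ) : 𝔸)) s) :
    ContDiffOn ℝ ∞ (fun p => ((((c p)⁻¹ : G) : 𝔸ˣ) : 𝔸)) s :=
  contDiffOn_units_inv (c := fun p => (c p : 𝔸ˣ)) hc

theorem exists_curve_of_velocity (hG : IsCompact (G : Set 𝔸ˣ)) (hI : IsOpen I)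
    (hIc : I.OrdConnected) {a : ℝ → 𝔸} (ha : ContDiffOn ℝ ∞ a I)
    (hmem : ∀ t ∈ I, a t ∈ lieAlg G) :
    ∃ k : ℝ → G, ContDiffOn ℝ ∞ (fun t => ((k t : 𝔸ˣ) : 𝔸)) I ∧
      ∀ t ∈ I, HasVelocityAt k (a t) t := by
  rcases I.eq_empty_or_nonempty with rfl | ⟨t₀, ht₀⟩
  · exact ⟨fun _ => 1, contDiffOn_const, fun t ht => ht.elim⟩
  · obtain ⟨k, -, hk⟩ := exists_curve hG hI hIc ha hmem ht₀ 1
    exact ⟨k, hk⟩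

theorem smooth_hasimoto (hI : IsOpen I) (hψ : Smooth I fun x t => ((ψ x t : 𝔸ˣ) : 𝔸)) :
    Smooth I (hasimoto ψ) :=
  hψ.units_inv.mul (hψ.dx hI)

theorem smooth_frameVel (hI : IsOpen I) (hψ : Smooth I fun x t => ((ψ x t : 𝔸ˣ) : 𝔸)) :
    Smooth I (frameVel ψ) :=
  hψ.units_inv.mul (hψ.dt hI)

theorem frameVel_mem (hI : IsOpen I) (hψ : Smooth I fun x t => ((ψ x t : 𝔸ˣ) : 𝔸)) (x : ℝ)
    {t : ℝ} (ht : t ∈ I) : frameVel ψ x t ∈ lieAlg G :=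
  (hasVelocityAt_frameVel hI hψ x ht).mem_lieAlg

theorem zero_curvature (hI : IsOpen I) (hψ : Smooth I fun x t => ((ψ x t : 𝔸ˣ) : 𝔸)) (x : ℝ)
    {t : ℝ} (ht : t ∈ I) :
    dx (frameVel ψ) x t = dt (hasimoto ψ) x t - ⁅hasimoto ψ x t, frameVel ψ x t⁆ := by
  let Ψ : ℝ → ℝ → 𝔸 := fun x t => ((ψ x t : 𝔸ˣ) : 𝔸)
  have hdt : dt Ψ = fun x t => Ψ x t * frameVel ψ x t := by
    funext x t
    simp only [frameVel, Ψ, Units.mul_inv_cancel_left]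
  have hdx : dx Ψ = fun x t => Ψ x t * hasimoto ψ x t := by
    funext x t
    simp only [hasimoto, Ψ, Units.mul_inv_cancel_left]
  have hdxdt : dx (dt Ψ) x t = Ψ x t * hasimoto ψ x t * frameVel ψ x t +
      Ψ x t * dx (frameVel ψ) x t := by
    rw [hdt]
    exact (HasDerivAt.mul (hasVelocityAt_hasimoto hI hψ x ht)
      ((smooth_frameVel hI hψ).hasDerivAt_dx hI x ht)).deriv
  have hdtdx : dt (dx Ψ) x t = Ψ x t * frameVel ψ x t * hasimoto ψ x t +
      Ψ x t * dt (hasimoto ψ) x t := by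
    rw [hdx]
    exact (HasDerivAt.mul (hasVelocityAt_frameVel hI hψ x ht)
      ((smooth_hasimoto hI hψ).hasDerivAt_dt hI x ht)).deriv
  have hcomm := hψ.dx_dt_comm hI x ht
  rw [hdxdt, hdtdx, mul_assoc, mul_assoc, ← mul_add, ← mul_add] at hcomm
  have hcancel := (Units.mul_right_inj _).1 hcomm
  rw [Ring.lie_def, eq_sub_iff_add_eq', sub_add_eq_add_sub, hcancel, add_sub_cancel_left]

theorem exists_eq_mul_of_velocity_eq (hI : IsOpen I) (hIc : I.OrdConnected)
    (hψ : Smooth I fun x t => ((ψ x t : 𝔸ˣ) : 𝔸)) (hψ' : Smooth I fun x t => ((ψ' x t : 𝔸ˣ) : 𝔸))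
    (hx : ∀ x, ∀ t ∈ I, hasimoto ψ' x t = hasimoto ψ x t)
    (ht : ∀ x, ∀ t ∈ I, frameVel ψ' x t = frameVel ψ x t) :
    ∃ g : G, ∀ x, ∀ t ∈ I, ψ' x t = g * ψ x t := by
  have hquot_x {x t : ℝ} (htI : t ∈ I) : ψ' x t * (ψ x t)⁻¹ = ψ' 0 t * (ψ 0 t)⁻¹ := by
    refine eq_of_hasVelocityAt_zero (k := fun x => ψ' x t * (ψ x t)⁻¹) isOpen_univ
      ordConnected_univ (fun y _ => ?_) (mem_univ x) (mem_univ 0)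
    exact .mul_inv_cancel (hx y t htI ▸ hasVelocityAt_hasimoto hI hψ' y htI)
      (hasVelocityAt_hasimoto hI hψ y htI)
  have hquot_t {s t : ℝ} (hs : s ∈ I) (htI : t ∈ I) :
      ψ' 0 s * (ψ 0 s)⁻¹ = ψ' 0 t * (ψ 0 t)⁻¹ := by
    refine eq_of_hasVelocityAt_zero (k := fun t => ψ' 0 t * (ψ 0 t)⁻¹) hI hIc
      (fun r hr => ?_) hs htI
    exact .mul_inv_cancel (ht 0 r hr ▸ hasVelocityAt_frameVel hI hψ' 0 hr)
      (hasVelocityAt_frameVel hI hψ 0 hr)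
  rcases I.eq_empty_or_nonempty with rfl | ⟨t₀, ht₀⟩
  · exact ⟨1, fun x t ht => ht.elim⟩
  · refine ⟨ψ' 0 t₀ * (ψ 0 t₀)⁻¹, fun x t htI => ?_⟩
    rw [← hquot_t htI ht₀, ← hquot_x htI, inv_mul_cancel_right]

end Frames

/-! ### The NLS velocity and parallel frames -/

section NLSVelocity

open Set Filter Topology

variable {𝔸 : Type*} [NormedRing 𝔸] [NormedAlgebra ℝ 𝔸] [FiniteDimensional ℝ 𝔸]
variable {G : Subgroup 𝔸ˣ} {I : Set ℝ}

namespace HermSymm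

variable (D : HermSymm G)

/-- The `t`-velocity `-J u_x + ½ [u, J u]` that a normalized frame with `x`-velocity `u` has. -/
def nlsVel (u : ℝ → ℝ → 𝔸) (x t : ℝ) : 𝔸 :=
  -⁅D.A, dx u x t⁆ + (1 / 2 : ℝ) • ⁅u x t, ⁅D.A, u x t⁆⁆

/-- The right-hand side `-J u_xx + ½ [u, [u, J u]]` of the NLS flow, in the time variable of the
Schrödinger map. -/
def nlsRhs (u : ℝ → ℝ → 𝔸) (x t : ℝ) : 𝔸 :=
  -⁅D.A, dx (dx u) x t⁆ + (1 / 2 : ℝ) • ⁅u x t, ⁅u x t, ⁅D.A, u x t⁆⁆⁆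

variable {u u' : ℝ → ℝ → 𝔸}

theorem nlsVel_congr (h : ∀ x, ∀ t ∈ I, u' x t = u x t) (x : ℝ) {t : ℝ} (ht : t ∈ I) :
    D.nlsVel u' x t = D.nlsVel u x t := by
  rw [nlsVel, nlsVel, h x t ht, dx_congr h x ht]

theorem smooth_nlsVel (hI : IsOpen I) (hu : Smooth I u) : Smooth I (D.nlsVel u) :=
  (((smooth_const D.A).lie (hu.dx hI)).neg).add
    ((hu.lie ((smooth_const D.A).lie hu)).const_smul _)

theorem nlsVel_Ad (hI : IsOpen I) (hu : Smooth I u) {k : G} (hk : k ∈ D.H) {t : ℝ} (ht : t ∈ I)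
    (h : ∀ x, u' x t = Ad (k : 𝔸ˣ) (u x t)) (x : ℝ) :
    D.nlsVel u' x t = Ad (k : 𝔸ˣ) (D.nlsVel u x t) := by
  have hdx : dx u' x t = Ad (k : 𝔸ˣ) (dx u x t) :=
    (congrArg (deriv · x) (funext h)).trans (dx_Ad hI hu _ x ht)
  rw [nlsVel, nlsVel, hdx, h, Ad_add, Ad_neg, D.Ad_A_lie hk, Ad_smul, Ad_lie, D.Ad_A_lie hk]

section Valued

variable (hI : IsOpen I) (hu : Smooth I u) (hm : ∀ x, ∀ t ∈ I, u x t ∈ D.𝔪)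

include hI hu hm

theorem dx_mem_m (x : ℝ) {t : ℝ} (ht : t ∈ I) : dx u x t ∈ D.𝔪 :=
  mem_submodule_of_hasDerivAt D.𝔪 (hu.hasDerivAt_dx hI x ht) (.of_forall fun y => hm y t ht)

theorem dt_mem_m (x : ℝ) {t : ℝ} (ht : t ∈ I) : dt u x t ∈ D.𝔪 :=
  mem_submodule_of_hasDerivAt D.𝔪 (hu.hasDerivAt_dt hI x ht)
    ((hI.eventually_mem ht).mono fun s hs => hm x s hs)

theorem nlsVel_mem (x : ℝ) {t : ℝ} (ht : t ∈ I) : D.nlsVel u x t ∈ lieAlg G :=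
  have hum := hm x t ht
  (lieAlg G).add_mem
    (D.mem_lieAlg_of_mem_m (D.𝔪.neg_mem (D.A_lie_m (D.dx_mem_m hI hu hm x ht))))
    (D.mem_lieAlg_of_mem_h (D.𝔥.smul_mem _ (D.lie_mm _ hum _ (D.A_lie_m hum))))

theorem nlsRhs_mem_m (x : ℝ) {t : ℝ} (ht : t ∈ I) : D.nlsRhs u x t ∈ D.𝔪 := by
  have hum := hm x t ht
  have hdxx := D.dx_mem_m hI (hu.dx hI) (fun x _ ht => D.dx_mem_m hI hu hm x ht) x ht
  exact D.𝔪.add_mem (D.𝔪.neg_mem (D.A_lie_m hdxx))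
    (D.𝔪.smul_mem _ (D.lie_mh hum (D.lie_mm _ hum _ (D.A_lie_m hum))))

theorem A_lie_nlsVel (x : ℝ) {t : ℝ} (ht : t ∈ I) : ⁅D.A, D.nlsVel u x t⁆ = dx u x t := by
  rw [nlsVel, lie_add, lie_neg, D.sq_eq _ (D.dx_mem_m hI hu hm x ht), neg_neg, lie_smul,
    D.A_lie_h (D.lie_mm _ (hm x t ht) _ (D.A_lie_m (hm x t ht))), smul_zero, add_zero]

theorem hasDerivAt_nlsVel (x : ℝ) {t : ℝ} (ht : t ∈ I) : HasDerivAt (fun y => D.nlsVel u y t)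
    (D.nlsRhs u x t - ⁅u x t, D.nlsVel u x t⁆) x := by
  have hux := hu.hasDerivAt_dx hI x ht
  have hA := hasDerivAt_const x D.A
  have hderiv := (hasDerivAt_lie hA ((hu.dx hI).hasDerivAt_dx hI x ht)).neg.add
    ((hasDerivAt_lie hux (hasDerivAt_lie hA hux)).const_smul (1 / 2 : ℝ))
  have hcomm : ⁅dx u x t, ⁅D.A, u x t⁆⁆ = ⁅u x t, ⁅D.A, dx u x t⁆⁆ :=
    D.lie_A_comm (D.dx_mem_m hI hu hm x ht) (hm x t ht)
  refine hderiv.congr_deriv ?_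
  simp only [nlsRhs, nlsVel, zero_lie, zero_add, lie_add, lie_neg, lie_smul, hcomm]
  module

end Valued

end HermSymm

end NLSVelocity

section ParallelFrames

open Set Filter Topology

variable {𝔸 : Type*} [NormedRing 𝔸] [NormedAlgebra ℝ 𝔸] [FiniteDimensional ℝ 𝔸]
variable {G : Subgroup 𝔸ˣ} {I : Set ℝ}

theorem exists_eqOn_forall_mem {X Γ : Type*} [Group Γ] (S : Subgroup Γ) {J : Set X} {k : X → Γ}
    (hk : ∀ t ∈ J, k t ∈ S) : ∃ K : X → Γ, (∀ t, K t ∈ S) ∧ EqOn K k J := by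
  refine ⟨J.mulIndicator k, fun t => ?_, eqOn_mulIndicator⟩
  by_cases ht : t ∈ J
  · simpa only [mulIndicator_of_mem ht] using hk t ht
  · simpa only [mulIndicator_of_notMem ht] using S.one_mem

namespace HermSymm

theorem mem_h_of_hasVelocityAt (D : HermSymm G) {k : ℝ → G} {a : 𝔸} {s : ℝ}
    (hk : ∀ᶠ r in 𝓝 s, k r ∈ D.H) (ha : HasVelocityAt k a s) : a ∈ D.𝔥 := by
  have hderiv : HasDerivAt (fun r => Ad (k r : 𝔸ˣ) D.A) 0 s :=
    (hasDerivAt_const s D.A).congr_of_eventuallyEq (hk.mono fun r hr => D.Ad_A hr)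
  have hlie := (ha.hasDerivAt_Ad (hasDerivAt_const s D.A)).unique hderiv
  rw [add_zero, ← lie_skew, Ad_neg, neg_eq_zero, D.Ad_A_lie hk.self_of_nhds] at hlie
  have hAd := (D.centralizer _ (Ad_mem (k s).2 ha.mem_lieAlg)).1 hlie
  refine (D.centralizer a ha.mem_lieAlg).1 (Ad_injective (k s : 𝔸ˣ) ?_)
  rw [D.Ad_A_lie hk.self_of_nhds, D.A_lie_h hAd, Ad, mul_zero, zero_mul]

variable {D : HermSymm G} {χ χ' : ℝ → ℝ → D.M} {ψ ψ' : ℝ → ℝ → G}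

namespace ParallelFrame

theorem congr_map (h : D.ParallelFrame I χ ψ) (hχ : ∀ x, ∀ t ∈ I, χ' x t = χ x t) :
    D.ParallelFrame I χ' ψ :=
  ⟨h.smooth, fun x t ht => (hχ x t ht).trans (h.lift x t ht), h.mem⟩

theorem emb_eq (h : D.ParallelFrame I χ ψ) (x : ℝ) {t : ℝ} (ht : t ∈ I) :
    D.emb (χ x t) = Ad (ψ x t : 𝔸ˣ) D.A := by
  rw [h.lift x t ht, D.emb_mk]

theorem smoothMap (h : D.ParallelFrame I χ ψ) : D.SmoothMap I χ :=
  (Smooth.Ad (c := fun x t => (ψ x t : 𝔸ˣ)) h.smooth (smooth_const D.A)).congr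
    fun x _ ht => h.emb_eq x ht

theorem mul_right (h : D.ParallelFrame I χ ψ) (hI : IsOpen I) {k : ℝ → G} (hkH : ∀ t, k t ∈ D.H)
    (hk : ContDiffOn ℝ ∞ (fun t => ((k t : 𝔸ˣ) : 𝔸)) I) :
    D.ParallelFrame I χ (fun x t => ψ x t * k t) where
  smooth := h.smooth.mul (smooth_of_contDiffOn hk)
  lift x t ht := (h.lift x t ht).trans
    (QuotientGroup.eq.2 (by simpa only [inv_mul_cancel_left] using hkH t))
  mem x t ht := by
    rw [hasimoto_mul_right hI h.smooth k x ht]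
    exact D.Ad_inv_mem_m (hkH t) (h.mem x t ht)

theorem smul (h : D.ParallelFrame I χ ψ) (hI : IsOpen I) {g : ℝ → G}
    (hg : ContDiffOn ℝ ∞ (fun t => ((g t : 𝔸ˣ) : 𝔸)) I) :
    D.ParallelFrame I (fun x t => g t • χ x t) (fun x t => g t * ψ x t) where
  smooth := (smooth_of_contDiffOn hg).mul h.smooth
  lift x t ht := congrArg (g t • ·) (h.lift x t ht)
  mem x t ht := by
    rw [hasimoto_mul_left hI h.smooth g x ht]
    exact h.mem x t ht

theorem translate (h : D.ParallelFrame I χ ψ) (L : ℝ) :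
    D.ParallelFrame I (fun x t => χ (x + L) t) (fun x t => ψ (x + L) t) where
  smooth := h.smooth.translate L
  lift x t ht := h.lift (x + L) t ht
  mem x t ht := by
    rw [hasimoto_translate]
    exact h.mem (x + L) t ht

variable (h : D.ParallelFrame I χ ψ) (hI : IsOpen I)

include h hI

theorem hasDerivAt_emb_x (x : ℝ) {t : ℝ} (ht : t ∈ I) :
    HasDerivAt (fun y => D.emb (χ y t)) (Ad (ψ x t : 𝔸ˣ) ⁅hasimoto ψ x t, D.A⁆) x := by
  rw [funext fun y => h.emb_eq y ht, ← add_zero ⁅hasimoto ψ x t, D.A⁆]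
  exact (hasVelocityAt_hasimoto hI h.smooth x ht).hasDerivAt_Ad (hasDerivAt_const x D.A)

theorem hasDerivAt_emb_t (x : ℝ) {t : ℝ} (ht : t ∈ I) :
    HasDerivAt (fun s => D.emb (χ x s)) (Ad (ψ x t : 𝔸ˣ) ⁅frameVel ψ x t, D.A⁆) t := by
  rw [← add_zero ⁅frameVel ψ x t, D.A⁆]
  exact ((hasVelocityAt_frameVel hI h.smooth x ht).hasDerivAt_Ad
    (hasDerivAt_const t D.A)).congr_of_eventuallyEq
      ((hI.eventually_mem ht).mono fun s hs => h.emb_eq x hs)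

theorem covDx_eq (x : ℝ) {t : ℝ} (ht : t ∈ I) :
    D.covDx χ (dx fun x t => D.emb (χ x t)) x t =
      Ad (ψ x t : 𝔸ˣ) ⁅dx (hasimoto ψ) x t, D.A⁆ := by
  have hu := smooth_hasimoto hI h.smooth
  have hdx : (fun y => dx (fun x t => D.emb (χ x t)) y t) =
      fun y => Ad (ψ y t : 𝔸ˣ) ⁅hasimoto ψ y t, D.A⁆ :=
    funext fun y => (h.hasDerivAt_emb_x hI y ht).deriv
  have hlie := hasDerivAt_lie (hu.hasDerivAt_dx hI x ht) (hasDerivAt_const x D.A)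
  rw [lie_zero, add_zero] at hlie
  have hdxx : dx (dx fun x t => D.emb (χ x t)) x t = _ := (congrArg (deriv · x) hdx).trans
    ((hasVelocityAt_hasimoto hI h.smooth x ht).hasDerivAt_Ad hlie).deriv
  have hnormal : ⁅hasimoto ψ x t, ⁅hasimoto ψ x t, D.A⁆⁆ ∈ D.𝔥 :=
    D.lie_mm _ (h.mem x t ht) _ (D.lie_mh (h.mem x t ht) D.A_mem)
  have htangent : ⁅dx (hasimoto ψ) x t, D.A⁆ ∈ D.𝔪 :=
    D.lie_mh (D.dx_mem_m hI hu h.mem x ht) D.A_mem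
  rw [covDx, hdxx, tangentProj, Jmap, Jmap, h.emb_eq x ht, ← Ad_lie, ← Ad_lie, lie_add,
    D.A_lie_h hnormal, zero_add, D.sq_eq _ htangent, Ad_neg, neg_neg]

theorem exists_gauge (h' : D.ParallelFrame I χ ψ') :
    ∃ k : ℝ → G, (∀ t, k t ∈ D.H) ∧ ContDiffOn ℝ ∞ (fun t => ((k t : 𝔸ˣ) : 𝔸)) I ∧
      ∀ x, ∀ t ∈ I, ψ' x t = ψ x t * k t := by
  have hH (x : ℝ) {t : ℝ} (ht : t ∈ I) : (ψ x t)⁻¹ * ψ' x t ∈ D.H :=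
    QuotientGroup.eq.1 ((h.lift x t ht).symm.trans (h'.lift x t ht))
  have hconst (x : ℝ) {t : ℝ} (ht : t ∈ I) : (ψ x t)⁻¹ * ψ' x t = (ψ 0 t)⁻¹ * ψ' 0 t := by
    refine eq_of_hasVelocityAt_zero (k := fun x => (ψ x t)⁻¹ * ψ' x t) isOpen_univ
      ordConnected_univ (fun y _ => ?_) (mem_univ x) (mem_univ 0)
    have hvel := (hasVelocityAt_hasimoto hI h.smooth y ht).inv.mul
      (hasVelocityAt_hasimoto hI h'.smooth y ht)
    have hAd : Ad (ψ' y t : 𝔸ˣ)⁻¹ (-Ad (ψ y t : 𝔸ˣ) (hasimoto ψ y t)) =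
        -Ad (((ψ y t)⁻¹ * ψ' y t : G) : 𝔸ˣ)⁻¹ (hasimoto ψ y t) := by
      rw [Ad_neg, ← Ad_mul, Subgroup.coe_mul, mul_inv_rev, Subgroup.coe_inv, inv_inv]
    have hvel_mem_m := D.𝔪.add_mem
      (D.𝔪.neg_mem (D.Ad_inv_mem_m (hH y ht) (h.mem y t ht))) (h'.mem y t ht)
    rw [← hAd] at hvel_mem_m
    rwa [D.eq_zero_of_mem_of_mem hvel_mem_m
      (D.mem_h_of_hasVelocityAt (.of_forall fun z => hH z ht) hvel)] at hvel
  obtain ⟨k, hkH, hk⟩ := exists_eqOn_forall_mem D.H fun t ht => hH 0 ht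
  refine ⟨k, hkH, ?_, fun x t ht => ?_⟩
  · exact (contDiffOn_mul_coe (contDiffOn_inv_coe (h.smooth.contDiffOn_slice 0))
      (h'.smooth.contDiffOn_slice 0)).congr fun t ht =>
        congrArg (fun g : G => ((g : 𝔸ˣ) : 𝔸)) (hk ht)
  · have hkt : k t = (ψ 0 t)⁻¹ * ψ' 0 t := hk ht
    rw [hkt, ← hconst x ht, mul_inv_cancel_left]

end ParallelFrame

end HermSymm

end ParallelFrames

/-! ### The defect of a parallel frame -/

section Defect

open Set Filter Topology

variable {𝔸 : Type*} [NormedRing 𝔸] [NormedAlgebra ℝ 𝔸] [FiniteDimensional ℝ 𝔸]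
variable {G : Subgroup 𝔸ˣ} {I : Set ℝ}

namespace HermSymm

/-- How far the frame `ψ` is from being normalized: its `t`-velocity minus the one prescribed by the
NLS flow of its `x`-velocity. -/
def velDefect (D : HermSymm G) (ψ : ℝ → ℝ → G) (x t : ℝ) : 𝔸 :=
  frameVel ψ x t - D.nlsVel (hasimoto ψ) x t

section Motions

variable (D : HermSymm G) {ψ ψ' : ℝ → ℝ → G}

theorem velDefect_congr (hI : IsOpen I) (h : ∀ x, ∀ t ∈ I, ψ' x t = ψ x t) (x : ℝ) {t : ℝ}
    (ht : t ∈ I) : D.velDefect ψ' x t = D.velDefect ψ x t := by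
  rw [velDefect, velDefect, frameVel_congr hI h x ht,
    D.nlsVel_congr (fun x _ ht => hasimoto_congr h x ht) x ht]

theorem velDefect_translate (ψ : ℝ → ℝ → G) (L x t : ℝ) :
    D.velDefect (fun x t => ψ (x + L) t) x t = D.velDefect ψ (x + L) t := by
  have hhas : hasimoto (fun x t => ψ (x + L) t) = fun x t => hasimoto ψ (x + L) t :=
    funext fun x => funext fun t => hasimoto_translate ψ L x t
  rw [velDefect, hhas, nlsVel, dx_translate]
  rfl

variable (hI : IsOpen I) (hψ : Smooth I fun x t => ((ψ x t : 𝔸ˣ) : 𝔸))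

include hI hψ

theorem smooth_velDefect : Smooth I (D.velDefect ψ) :=
  (smooth_frameVel hI hψ).sub (D.smooth_nlsVel hI (smooth_hasimoto hI hψ))

theorem velDefect_mul_right {k : ℝ → G} {a : 𝔸} (x : ℝ) {t : ℝ} (ht : t ∈ I) (hkH : k t ∈ D.H)
    (hk : HasVelocityAt k a t) :
    D.velDefect (fun x t => ψ x t * k t) x t = Ad (k t : 𝔸ˣ)⁻¹ (D.velDefect ψ x t) + a := by
  have hnls : D.nlsVel (hasimoto fun x t => ψ x t * k t) x t =
      Ad (k t : 𝔸ˣ)⁻¹ (D.nlsVel (hasimoto ψ) x t) :=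
    D.nlsVel_Ad hI (smooth_hasimoto hI hψ) (D.H.inv_mem hkH) ht
      (fun x => hasimoto_mul_right hI hψ k x ht) x
  rw [velDefect, velDefect, hnls, frameVel_mul_right hI hψ x ht hk, sub_eq_add_neg, sub_eq_add_neg,
    Ad_add, Ad_neg, add_right_comm]

theorem velDefect_mul_left {g : ℝ → G} {a : 𝔸} (x : ℝ) {t : ℝ} (ht : t ∈ I)
    (hg : HasVelocityAt g a t) :
    D.velDefect (fun x t => g t * ψ x t) x t = Ad (ψ x t : 𝔸ˣ)⁻¹ a + D.velDefect ψ x t := by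
  rw [velDefect, velDefect, frameVel_mul_left hI hψ x ht hg,
    D.nlsVel_congr (fun x _ ht => hasimoto_mul_left hI hψ g x ht) x ht, add_sub_assoc]

end Motions

variable {D : HermSymm G} {χ : ℝ → ℝ → D.M} {ψ : ℝ → ℝ → G}

namespace ParallelFrame

variable (h : D.ParallelFrame I χ ψ) (hI : IsOpen I)

include h hI

theorem velDefect_mem (x : ℝ) {t : ℝ} (ht : t ∈ I) : D.velDefect ψ x t ∈ lieAlg G :=
  (lieAlg G).sub_mem (frameVel_mem hI h.smooth x ht)
    (D.nlsVel_mem hI (smooth_hasimoto hI h.smooth) h.mem x ht)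

theorem hasDerivAt_velDefect (x : ℝ) {t : ℝ} (ht : t ∈ I) :
    HasDerivAt (fun y => D.velDefect ψ y t)
      (dt (hasimoto ψ) x t - D.nlsRhs (hasimoto ψ) x t -
        ⁅hasimoto ψ x t, D.velDefect ψ x t⁆) x := by
  refine (((smooth_frameVel hI h.smooth).hasDerivAt_dx hI x ht).sub
    (D.hasDerivAt_nlsVel hI (smooth_hasimoto hI h.smooth) h.mem x ht)).congr_deriv ?_
  rw [zero_curvature hI h.smooth x ht, velDefect, lie_sub]
  abel

theorem hasDerivAt_Ad_velDefect (x : ℝ) {t : ℝ} (ht : t ∈ I) :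
    HasDerivAt (fun y => Ad (ψ y t : 𝔸ˣ) (D.velDefect ψ y t))
      (Ad (ψ x t : 𝔸ˣ) (dt (hasimoto ψ) x t - D.nlsRhs (hasimoto ψ) x t)) x := by
  simpa only [add_sub_cancel] using (hasVelocityAt_hasimoto hI h.smooth x ht).hasDerivAt_Ad
    (h.hasDerivAt_velDefect hI x ht)

theorem schrodinger_iff_lie :
    D.SchrodingerMap I χ ↔ ∀ x, ∀ t ∈ I, ⁅D.A, frameVel ψ x t⁆ = dx (hasimoto ψ) x t := by
  refine forall_congr' fun x => forall_congr' fun t => forall_congr' fun ht => ?_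
  have hux := D.dx_mem_m hI (smooth_hasimoto hI h.smooth) h.mem x ht
  have hemb_t : dt (fun x t => D.emb (χ x t)) x t = _ := (h.hasDerivAt_emb_t hI x ht).deriv
  rw [hemb_t, h.covDx_eq hI x ht, Jmap, h.emb_eq x ht, ← Ad_lie, ← Ad_neg,
    (Ad_injective _).eq_iff, ← lie_skew (frameVel ψ x t) D.A,
    ← lie_skew (dx (hasimoto ψ) x t) D.A, lie_neg, D.sq_eq _ hux, neg_neg, neg_inj]

theorem schrodinger_iff : D.SchrodingerMap I χ ↔ ∀ x, ∀ t ∈ I, D.velDefect ψ x t ∈ D.𝔥 := by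
  refine (h.schrodinger_iff_lie hI).trans
    (forall_congr' fun x => forall_congr' fun t => forall_congr' fun ht => ?_)
  rw [← D.centralizer _ (h.velDefect_mem hI x ht), velDefect, lie_sub,
    D.A_lie_nlsVel hI (smooth_hasimoto hI h.smooth) h.mem x ht, sub_eq_zero]

theorem velDefect_eq_velDefect_zero (hS : D.SchrodingerMap I χ) (x : ℝ) {t : ℝ} (ht : t ∈ I) :
    D.velDefect ψ x t = D.velDefect ψ 0 t := by
  have hmem := (h.schrodinger_iff hI).1 hS
  have hu := smooth_hasimoto hI h.smooth
  refine eq_of_hasDerivAt_zero (c := fun x => D.velDefect ψ x t) isOpen_univ ordConnected_univ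
    (fun y _ => ?_) (mem_univ x) (mem_univ 0)
  have hderiv := h.hasDerivAt_velDefect hI y ht
  have hderiv_mem_h := mem_submodule_of_hasDerivAt D.𝔥 hderiv (.of_forall fun z => hmem z t ht)
  have hderiv_mem_m := D.𝔪.sub_mem (D.𝔪.sub_mem (D.dt_mem_m hI hu h.mem y ht)
    (D.nlsRhs_mem_m hI hu h.mem y ht)) (D.lie_mh (h.mem y t ht) (hmem y t ht))
  exact hderiv.congr_deriv (D.eq_zero_of_mem_of_mem hderiv_mem_m hderiv_mem_h)

theorem Ad_velDefect_eq_Ad_velDefect_zero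
    (hNLS : ∀ x, ∀ t ∈ I, dt (hasimoto ψ) x t = D.nlsRhs (hasimoto ψ) x t) (x : ℝ) {t : ℝ}
    (ht : t ∈ I) :
    Ad (ψ x t : 𝔸ˣ) (D.velDefect ψ x t) = Ad (ψ 0 t : 𝔸ˣ) (D.velDefect ψ 0 t) := by
  refine eq_of_hasDerivAt_zero (c := fun x => Ad (ψ x t : 𝔸ˣ) (D.velDefect ψ x t)) isOpen_univ
    ordConnected_univ (fun y _ => ?_) (mem_univ x) (mem_univ 0)
  refine (h.hasDerivAt_Ad_velDefect hI y ht).congr_deriv ?_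
  rw [hNLS y t ht, sub_self, Ad, mul_zero, zero_mul]

end ParallelFrame

end HermSymm

end Defect

/-! ### Existence of parallel frames -/

section Transport

open Set Filter Topology

variable {𝔸 : Type*} [NormedRing 𝔸] [NormedAlgebra ℝ 𝔸] [FiniteDimensional ℝ 𝔸]
variable {G : Subgroup 𝔸ˣ} {I : Set ℝ}

namespace HermSymm

variable (D : HermSymm G)

theorem smul_eq_smul_of_transport (hss : LieAlgebra.IsSemisimple ℝ (lieAlg G)) {J : Set ℝ}
    (hJ : IsOpen J) (hJc : J.OrdConnected) {p : ℝ → D.M} {p' : ℝ → 𝔸} {k : ℝ → G}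
    (hp : ∀ s ∈ J, HasDerivAt (fun r => D.emb (p r)) (p' s) s)
    (hk : ∀ s ∈ J, HasVelocityAt k (-⁅D.emb (p s), p' s⁆) s) {s r : ℝ} (hs : s ∈ J) (hr : r ∈ J) :
    k s • p s = k r • p r := by
  refine D.emb_injective (eq_of_hasDerivAt_zero (c := fun s => D.emb (k s • p s)) hJ hJc
    (fun s hs => ?_) hs hr)
  rw [funext fun s => D.emb_smul (k s) (p s)]
  refine ((hk s hs).hasDerivAt_Ad (hp s hs)).congr_deriv ?_
  rw [neg_lie, lie_skew, D.lie_emb_lie_emb_deriv hss (hp s hs), neg_add_cancel, Ad, mul_zero,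
    zero_mul]

variable {D} {χ : ℝ → ℝ → D.M}

theorem SmoothMap.dx_mem (hχ : D.SmoothMap I χ) (hI : IsOpen I) (x : ℝ) {t : ℝ} (ht : t ∈ I) :
    dx (fun x t => D.emb (χ x t)) x t ∈ lieAlg G :=
  mem_submodule_of_hasDerivAt (lieAlg G).toSubmodule (Smooth.hasDerivAt_dx hχ hI x ht)
    (.of_forall fun _ => D.emb_mem _)

theorem SmoothMap.dt_mem (hχ : D.SmoothMap I χ) (hI : IsOpen I) (x : ℝ) {t : ℝ} (ht : t ∈ I) :
    dt (fun x t => D.emb (χ x t)) x t ∈ lieAlg G :=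
  mem_submodule_of_hasDerivAt (lieAlg G).toSubmodule (Smooth.hasDerivAt_dt hχ hI x ht)
    (.of_forall fun _ => D.emb_mem _)

theorem SmoothMap.exists_smul_eq_basepoint (hχ : D.SmoothMap I χ) (hG : IsCompact (G : Set 𝔸ˣ))
    (hss : LieAlgebra.IsSemisimple ℝ (lieAlg G)) (hI : IsOpen I) (hIc : I.OrdConnected) (x : ℝ) :
    ∃ k : ℝ → G, ContDiffOn ℝ ∞ (fun t => ((k t : 𝔸ˣ) : 𝔸)) I ∧
      ∀ t ∈ I, k t • χ x t = QuotientGroup.mk 1 := by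
  rcases I.eq_empty_or_nonempty with rfl | ⟨t₀, ht₀⟩
  · exact ⟨fun _ => 1, contDiffOn_const, fun t ht => ht.elim⟩
  obtain ⟨g₀, hg₀⟩ := QuotientGroup.mk_surjective (χ x t₀)
  obtain ⟨k, hk₀, hk, hvel⟩ := exists_curve hG hI hIc
    ((Smooth.lie hχ (Smooth.dt hχ hI)).neg.contDiffOn_slice x)
    (fun t ht => (lieAlg G).neg_mem ((lieAlg G).lie_mem (D.emb_mem _) (hχ.dt_mem hI x ht)))
    ht₀ g₀⁻¹
  refine ⟨k, hk, fun t ht => ?_⟩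
  rw [D.smul_eq_smul_of_transport hss hI hIc (fun s hs => Smooth.hasDerivAt_dt hχ hI x hs) hvel
    ht ht₀, hk₀, ← hg₀, MulAction.Quotient.smul_mk, smul_eq_mul, inv_mul_cancel]

theorem exists_parallelFrame (hG : IsCompact (G : Set 𝔸ˣ))
    (hss : LieAlgebra.IsSemisimple ℝ (lieAlg G)) (hI : IsOpen I) (hIc : I.OrdConnected)
    (hχ : D.SmoothMap I χ) : ∃ ψ, D.ParallelFrame I χ ψ := by
  obtain ⟨k, hk, hkχ⟩ := hχ.exists_smul_eq_basepoint hG hss hI hIc 0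
  obtain ⟨m, hm, hm₀, hvel⟩ := exists_family hG hI (Smooth.lie hχ (Smooth.dx hχ hI)).neg
    (fun x t ht => (lieAlg G).neg_mem ((lieAlg G).lie_mem (D.emb_mem _) (hχ.dx_mem hI x ht))) hk
  have hmχ (x : ℝ) {t : ℝ} (ht : t ∈ I) : m x t • χ x t = QuotientGroup.mk 1 := by
    rw [D.smul_eq_smul_of_transport hss (p := fun x => χ x t) (k := fun x => m x t) isOpen_univ
      ordConnected_univ (fun y _ => Smooth.hasDerivAt_dx hχ hI y ht) (fun y _ => hvel y t ht)
      (mem_univ x) (mem_univ 0), hm₀ t ht, hkχ t ht]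
  refine ⟨fun x t => (m x t)⁻¹, Smooth.units_inv hm, fun x t ht => ?_, fun x t ht => ?_⟩
  · rw [eq_inv_smul_iff.2 (hmχ x ht), MulAction.Quotient.smul_mk, smul_eq_mul, mul_one]
  · have hAd : Ad (m x t : 𝔸ˣ) (D.emb (χ x t)) = D.A := by
      rw [← D.emb_smul, hmχ x ht, D.emb_mk, Subgroup.coe_one, Ad_one]
    rw [hasimoto_eq (hvel x t ht).inv, Ad_neg, neg_neg, Ad_lie, hAd]
    exact D.A_lie_mem (Ad_mem (m x t).2 (hχ.dx_mem hI x ht))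

end HermSymm

end Transport

/-! ### The Hasimoto correspondence -/

section Correspondence

open Set Filter Topology

variable {𝔸 : Type*} [NormedRing 𝔸] [NormedAlgebra ℝ 𝔸] [FiniteDimensional ℝ 𝔸]
variable {G : Subgroup 𝔸ˣ} {I : Set ℝ}

namespace HermSymm

theorem NLS_iff (D : HermSymm G) (hρ : 0 < D.normSqA) (hI : IsOpen I) {q u : ℝ → ℝ → 𝔸}
    (hqu : ∀ x, ∀ t ∈ scaleTime D.normSqA I, q x t = u x (D.normSqA * t)) :
    D.NLS (scaleTime D.normSqA I) q ↔ Smooth I u ∧ (∀ x, ∀ t ∈ I, u x t ∈ D.𝔪) ∧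
      ∀ x, ∀ t ∈ I, dt u x t = D.nlsRhs u x t := by
  have hsmooth : Smooth (scaleTime D.normSqA I) q ↔ Smooth I u := by
    refine ⟨fun hq => ?_, fun hu => (hu.scaleTime _).congr hqu⟩
    rw [← scaleTime_inv_scaleTime hρ.ne' I]
    refine (hq.scaleTime D.normSqA⁻¹).congr fun x t ht => ?_
    rw [hqu x _ ht, mul_inv_cancel_left₀ hρ.ne']
  have hdt (x : ℝ) {t : ℝ} (ht : t ∈ scaleTime D.normSqA I) :
      (1 / D.normSqA) • dt q x t = dt u x (D.normSqA * t) := by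
    rw [dt_congr (isOpen_scaleTime hI _) hqu x ht, dt_comp_mul, one_div, inv_smul_smul₀ hρ.ne']
  have hdxx (x : ℝ) {t : ℝ} (ht : t ∈ scaleTime D.normSqA I) :
      dx (dx q) x t = dx (dx u) x (D.normSqA * t) :=
    dx_congr (g := fun x t => dx u x (D.normSqA * t)) (fun x _ ht => dx_congr hqu x ht) x ht
  rw [← hsmooth, ← forall_scaleTime hρ.ne' (P := fun x t => u x t ∈ D.𝔪),
    ← forall_scaleTime hρ.ne' (P := fun x t => dt u x t = D.nlsRhs u x t)]
  refine ⟨fun h => ⟨h.smooth, fun x t ht => hqu x t ht ▸ h.mem x t ht, fun x t ht => ?_⟩,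
    fun ⟨hq, hm, heqn⟩ => ⟨hq, fun x t ht => (hqu x t ht).symm ▸ hm x t ht, fun x t ht => ?_⟩⟩
  · rw [← hdt x ht, h.eqn x t ht, hdxx x ht, hqu x t ht, nlsRhs]
  · rw [hdt x ht, heqn x t ht, hdxx x ht, hqu x t ht, nlsRhs]

theorem NLS.map_Ad {D : HermSymm G} {q : ℝ → ℝ → 𝔸} (hq : D.NLS I q) (hI : IsOpen I) {k : G}
    (hk : k ∈ D.H) : D.NLS I fun x t => Ad (k : 𝔸ˣ) (q x t) where
  smooth := Smooth.Ad (c := fun _ _ => (k : 𝔸ˣ)) contDiffOn_const hq.smooth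
  mem x t ht := D.Ad_mem_m hk (hq.mem x t ht)
  eqn x t ht := by
    have hdxx : dx (dx fun x t => Ad (k : 𝔸ˣ) (q x t)) x t = Ad (k : 𝔸ˣ) (dx (dx q) x t) :=
      (dx_congr (fun x _ ht => dx_Ad hI hq.smooth _ x ht) x ht).trans
        (dx_Ad hI (hq.smooth.dx hI) _ x ht)
    rw [dt_Ad hI hq.smooth _ x ht, hdxx, ← Ad_smul, hq.eqn x t ht]
    simp only [Ad_add, Ad_neg, Ad_smul, Ad_lie, D.Ad_A hk]

theorem exists_stabilizer_curve (D : HermSymm G) (hG : IsCompact (G : Set 𝔸ˣ)) (hI : IsOpen I)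
    (hIc : I.OrdConnected) {a : ℝ → 𝔸} (ha : ContDiffOn ℝ ∞ a I) (hmem : ∀ t ∈ I, a t ∈ D.𝔥) :
    ∃ k : ℝ → G, (∀ t, k t ∈ D.H) ∧ ContDiffOn ℝ ∞ (fun t => ((k t : 𝔸ˣ) : 𝔸)) I ∧
      ∀ t ∈ I, HasVelocityAt k (a t) t := by
  rcases I.eq_empty_or_nonempty with rfl | ⟨t₀, ht₀⟩
  · exact ⟨fun _ => 1, fun _ => D.H.one_mem, contDiffOn_const, fun t ht => ht.elim⟩
  obtain ⟨k, hk₀, hk, hvel⟩ := exists_curve hG hI hIc ha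
    (fun t ht => D.mem_lieAlg_of_mem_h (hmem t ht)) ht₀ 1
  have hkH : ∀ t ∈ I, k t ∈ D.H := fun t ht => by
    have hconst : Ad (k t : 𝔸ˣ) D.A = Ad (k t₀ : 𝔸ˣ) D.A :=
      eq_of_hasDerivAt_zero (c := fun t => Ad (k t : 𝔸ˣ) D.A) hI hIc (fun s hs => by
        refine ((hvel s hs).hasDerivAt_Ad (hasDerivAt_const s D.A)).congr_deriv ?_
        rw [add_zero, ← lie_skew, D.A_lie_h (hmem s hs), neg_zero, Ad, mul_zero, zero_mul]) ht ht₀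
    rw [hk₀] at hconst
    exact hconst.trans (Ad_one _)
  obtain ⟨K, hKH, hK⟩ := exists_eqOn_forall_mem D.H hkH
  exact ⟨K, hKH, hk.congr fun t ht => by rw [hK ht],
    fun t ht => (hvel t ht).congr_of_eventuallyEq (hK.eventuallyEq_of_mem (hI.mem_nhds ht))⟩

variable {D : HermSymm G} {χ χ' : ℝ → ℝ → D.M} {ψ ψ' : ℝ → ℝ → G} {q q' : ℝ → ℝ → 𝔸}

theorem ParallelFrame.hasimotoFrame (h : D.ParallelFrame I χ ψ)
    (hv : ∀ x, ∀ t ∈ I, D.velDefect ψ x t = 0)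
    (hq : ∀ x, ∀ t ∈ scaleTime D.normSqA I, q x t = hasimoto ψ x (D.normSqA * t)) :
    D.HasimotoFrame I χ ψ q :=
  ⟨h, hq, fun x t ht => sub_eq_zero.1 (hv x t ht)⟩

theorem ParallelFrame.exists_normalizing_gauge (h : D.ParallelFrame I χ ψ)
    (hG : IsCompact (G : Set 𝔸ˣ)) (hI : IsOpen I) (hIc : I.OrdConnected)
    (hS : D.SchrodingerMap I χ) :
    ∃ k : ℝ → G, (∀ t, k t ∈ D.H) ∧ ContDiffOn ℝ ∞ (fun t => ((k t : 𝔸ˣ) : 𝔸)) I ∧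
      D.HasimotoFrame I χ (fun x t => ψ x t * k t)
        (fun x t => hasimoto (fun x t => ψ x t * k t) x (D.normSqA * t)) := by
  obtain ⟨κ, hκH, hκ, hvel⟩ := D.exists_stabilizer_curve hG hI hIc
    ((D.smooth_velDefect hI h.smooth).contDiffOn_slice 0)
    fun t ht => (h.schrodinger_iff hI).1 hS 0 t ht
  have hkH (t : ℝ) : (κ t)⁻¹ ∈ D.H := D.H.inv_mem (hκH t)
  have hk := contDiffOn_inv_coe hκ
  refine ⟨fun t => (κ t)⁻¹, hkH, hk,
    (h.mul_right hI hkH hk).hasimotoFrame (fun x t ht => ?_) fun _ _ _ => rfl⟩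
  rw [D.velDefect_mul_right hI h.smooth x ht (hkH t) (hvel t ht).inv, Subgroup.coe_inv, inv_inv,
    h.velDefect_eq_velDefect_zero hI hS x ht, add_neg_cancel]

theorem ParallelFrame.exists_normalizing_motion (h : D.ParallelFrame I χ ψ)
    (hG : IsCompact (G : Set 𝔸ˣ)) (hρ : 0 < D.normSqA) (hI : IsOpen I) (hIc : I.OrdConnected)
    (hqu : ∀ x, ∀ t ∈ scaleTime D.normSqA I, q x t = hasimoto ψ x (D.normSqA * t))
    (hq : D.NLS (scaleTime D.normSqA I) q) :
    ∃ g : ℝ → G, ContDiffOn ℝ ∞ (fun t => ((g t : 𝔸ˣ) : 𝔸)) I ∧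
      D.HasimotoFrame I (fun x t => g t • χ x t) (fun x t => g t * ψ x t) q := by
  obtain ⟨-, -, hNLS⟩ := (D.NLS_iff hρ hI hqu).1 hq
  obtain ⟨g, hg, hvel⟩ := exists_curve_of_velocity hG hI hIc
    ((Smooth.Ad (c := fun x t => (ψ x t : 𝔸ˣ)) h.smooth
      (D.smooth_velDefect hI h.smooth)).neg.contDiffOn_slice 0)
    fun t ht => (lieAlg G).neg_mem (Ad_mem (ψ 0 t).2 (h.velDefect_mem hI 0 ht))
  refine ⟨g, hg, (h.smul hI hg).hasimotoFrame (fun x t ht => ?_) fun x t ht => ?_⟩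
  · rw [D.velDefect_mul_left hI h.smooth x ht (hvel t ht),
      ← h.Ad_velDefect_eq_Ad_velDefect_zero hI hNLS x ht, Ad_neg, Ad_inv_Ad, neg_add_cancel]
  · rw [hqu x t ht, hasimoto_mul_left hI h.smooth g x ht]

namespace HasimotoFrame

variable (h : D.HasimotoFrame I χ ψ q)

include h

theorem velDefect_eq_zero (x : ℝ) {t : ℝ} (ht : t ∈ I) : D.velDefect ψ x t = 0 :=
  sub_eq_zero.2 (h.vel x t ht)

theorem frameVel_eq_nlsVel (x : ℝ) {t : ℝ} (ht : t ∈ I) :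
    frameVel ψ x t = D.nlsVel (hasimoto ψ) x t :=
  h.vel x t ht

variable (hI : IsOpen I)

include hI

theorem schrodinger : D.SchrodingerMap I χ :=
  (h.parallel.schrodinger_iff hI).2 fun x _ ht => h.velDefect_eq_zero x ht ▸ D.𝔥.zero_mem

theorem nls (hρ : 0 < D.normSqA) : D.NLS (scaleTime D.normSqA I) q := by
  refine (D.NLS_iff hρ hI h.q_eq).2
    ⟨smooth_hasimoto hI h.parallel.smooth, h.parallel.mem, fun x t ht => ?_⟩
  have hconst : HasDerivAt (fun y => D.velDefect ψ y t) 0 x := by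
    rw [funext fun y => h.velDefect_eq_zero y ht]
    exact hasDerivAt_const x 0
  have hderiv := (h.parallel.hasDerivAt_velDefect hI x ht).unique hconst
  rwa [h.velDefect_eq_zero x ht, lie_zero, sub_zero, sub_eq_zero] at hderiv

theorem mul_right {k : G} (hk : k ∈ D.H) :
    D.HasimotoFrame I χ (fun x t => ψ x t * k) fun x t => Ad (k : 𝔸ˣ)⁻¹ (q x t) := by
  refine (h.parallel.mul_right hI (fun _ => hk) contDiffOn_const).hasimotoFrame
    (fun x t ht => ?_) fun x t ht => ?_
  · rw [D.velDefect_mul_right hI h.parallel.smooth x ht hk (.const k t), h.velDefect_eq_zero x ht,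
      Ad, mul_zero, zero_mul, add_zero]
  · rw [h.q_eq x t ht, hasimoto_mul_right hI h.parallel.smooth (fun _ => k) x ht]

theorem smul (g : G) : D.HasimotoFrame I (fun x t => g • χ x t) (fun x t => g * ψ x t) q := by
  refine (h.parallel.smul hI contDiffOn_const).hasimotoFrame (fun x t ht => ?_) fun x t ht => ?_
  · rw [D.velDefect_mul_left hI h.parallel.smooth x ht (.const g t), h.velDefect_eq_zero x ht,
      Ad, mul_zero, zero_mul, add_zero]
  · rw [h.q_eq x t ht, hasimoto_mul_left hI h.parallel.smooth (fun _ => g) x ht]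

omit hI in
theorem translate (L : ℝ) :
    D.HasimotoFrame I (fun x t => χ (x + L) t) (fun x t => ψ (x + L) t) fun x t => q (x + L) t := by
  refine (h.parallel.translate L).hasimotoFrame (fun x t ht => ?_) fun x t ht => ?_
  · rw [D.velDefect_translate, h.velDefect_eq_zero (x + L) ht]
  · rw [h.q_eq (x + L) t ht, hasimoto_translate]

omit hI in
theorem congr_map (hχ : ∀ x, ∀ t ∈ I, χ' x t = χ x t) : D.HasimotoFrame I χ' ψ q :=
  ⟨h.parallel.congr_map hχ, h.q_eq, h.vel⟩

variable (hIc : I.OrdConnected)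

include hIc

theorem exists_eq_mul (h' : D.HasimotoFrame I χ ψ' q') :
    ∃ k ∈ D.H, ∀ x, ∀ t ∈ I, ψ' x t = ψ x t * k := by
  rcases I.eq_empty_or_nonempty with rfl | ⟨t₀, ht₀⟩
  · exact ⟨1, D.H.one_mem, fun x t ht => ht.elim⟩
  obtain ⟨k, hkH, hk, hψ'⟩ := h.parallel.exists_gauge hI h'.parallel
  have hk₀ : ∀ t ∈ I, HasVelocityAt k 0 t := fun t ht => by
    obtain ⟨a, ha⟩ := exists_hasVelocityAt hI hk ht
    have hdefect := D.velDefect_mul_right hI h.parallel.smooth 0 ht (hkH t) ha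
    rw [← D.velDefect_congr hI hψ' 0 ht, h'.velDefect_eq_zero 0 ht, h.velDefect_eq_zero 0 ht, Ad,
      mul_zero, zero_mul, zero_add] at hdefect
    rwa [← hdefect] at ha
  refine ⟨k t₀, hkH t₀, fun x t ht => ?_⟩
  rw [hψ' x t ht, eq_of_hasVelocityAt_zero hI hIc hk₀ ht ht₀]

theorem exists_smul_of_eq (hρ : 0 < D.normSqA) (h' : D.HasimotoFrame I χ' ψ' q')
    (hq : ∀ x, ∀ t ∈ scaleTime D.normSqA I, q' x t = q x t) :
    ∃ g : G, ∀ x, ∀ t ∈ I, χ' x t = g • χ x t := by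
  have hhas : ∀ x, ∀ t ∈ I, hasimoto ψ' x t = hasimoto ψ x t :=
    (forall_scaleTime hρ.ne').1 fun x t ht => by rw [← h'.q_eq x t ht, hq x t ht, h.q_eq x t ht]
  obtain ⟨g, hg⟩ := exists_eq_mul_of_velocity_eq hI hIc h.parallel.smooth h'.parallel.smooth hhas
    fun x t ht => by
      rw [h'.frameVel_eq_nlsVel x ht, D.nlsVel_congr hhas x ht, h.frameVel_eq_nlsVel x ht]
  refine ⟨g, fun x t ht => ?_⟩
  rw [h'.parallel.lift x t ht, h.parallel.lift x t ht, hg x t ht]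
  rfl

theorem exists_smul_iff (hρ : 0 < D.normSqA) (h' : D.HasimotoFrame I χ' ψ' q') :
    (∃ g : G, ∀ x, ∀ t ∈ I, χ' x t = g • χ x t) ↔
      ∃ k ∈ D.H, ∀ x, ∀ t ∈ scaleTime D.normSqA I, q' x t = Ad (k : 𝔸ˣ) (q x t) := by
  constructor
  · rintro ⟨g, hg⟩
    have hmoved := (h.smul hI g).congr_map hg
    obtain ⟨k, hk, hψ'⟩ := hmoved.exists_eq_mul hI hIc h'
    refine ⟨k⁻¹, D.H.inv_mem hk, fun x t ht => ?_⟩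
    rw [h'.q_eq x t ht, hasimoto_congr hψ' x ht, ← (hmoved.mul_right hI hk).q_eq x t ht,
      Subgroup.coe_inv]
  · rintro ⟨k, hk, hq⟩
    refine h.exists_smul_of_eq hI hIc hρ (h'.mul_right hI hk) fun x t ht => ?_
    rw [hq x t ht, Ad_inv_Ad]

theorem periodic_iff (L : ℝ) :
    (∀ x, ∀ t ∈ I, χ (x + L) t = χ x t) ↔
      ∃ k ∈ D.H, ∀ x, ∀ t ∈ I, ψ (x + L) t = ψ x t * k := by
  refine ⟨fun hper => h.exists_eq_mul hI hIc
    ((h.translate L).congr_map fun x t ht => (hper x t ht).symm), ?_⟩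
  rintro ⟨k, hk, hψ⟩ x t ht
  rw [h.parallel.lift (x + L) t ht, h.parallel.lift x t ht, hψ x t ht,
    QuotientGroup.mk_mul_of_mem _ hk]

end HasimotoFrame

theorem NLS.exists_hasimotoFrame (hq : D.NLS (scaleTime D.normSqA I) q)
    (hG : IsCompact (G : Set 𝔸ˣ)) (hρ : 0 < D.normSqA) (hI : IsOpen I) (hIc : I.OrdConnected) :
    ∃ (χ : ℝ → ℝ → D.M) (ψ : ℝ → ℝ → G), D.HasimotoFrame I χ ψ q := by
  let u : ℝ → ℝ → 𝔸 := fun x t => q x (t / D.normSqA)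
  have hqu : ∀ x, ∀ t ∈ scaleTime D.normSqA I, q x t = u x (D.normSqA * t) := fun x t _ => by
    simp only [u, mul_div_cancel_left₀ _ hρ.ne']
  obtain ⟨hu, hm, -⟩ := (D.NLS_iff hρ hI hqu).1 hq
  obtain ⟨φ, hφ, hφvel⟩ := exists_curve_of_velocity hG hI hIc
    ((D.smooth_nlsVel hI hu).contDiffOn_slice 0) fun t ht => D.nlsVel_mem hI hu hm 0 ht
  obtain ⟨ψ, hψ, hψ₀, hψvel⟩ := exists_family hG hI hu
    (fun x t ht => D.mem_lieAlg_of_mem_m (hm x t ht)) hφ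
  have hhas : ∀ x, ∀ t ∈ I, hasimoto ψ x t = u x t := fun x t ht => hasimoto_eq (hψvel x t ht)
  have hpar : D.ParallelFrame I (fun x t => QuotientGroup.mk (ψ x t)) ψ :=
    ⟨hψ, fun _ _ _ => rfl, fun x t ht => (hhas x t ht).symm ▸ hm x t ht⟩
  have hdefect₀ {t : ℝ} (ht : t ∈ I) : D.velDefect ψ 0 t = 0 := by
    have hvel : HasVelocityAt (ψ 0) (D.nlsVel u 0 t) t :=
      (hφvel t ht).congr_of_eventuallyEq ((hI.eventually_mem ht).mono hψ₀)
    rw [velDefect, frameVel_eq hvel, D.nlsVel_congr hhas 0 ht, sub_self]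
  obtain ⟨-, -, hψNLS⟩ := (D.NLS_iff hρ hI (u := hasimoto ψ)
    fun x t ht => (hqu x t ht).trans (hhas x _ ht).symm).1 hq
  refine ⟨_, ψ, hpar.hasimotoFrame (fun x t ht => ?_) fun x t ht => ?_⟩
  · refine Ad_injective (ψ x t : 𝔸ˣ) ?_
    rw [hpar.Ad_velDefect_eq_Ad_velDefect_zero hI hψNLS x ht, hdefect₀ ht, Ad, Ad, mul_zero,
      zero_mul, mul_zero, zero_mul]
  · rw [hqu x t ht, hhas x _ ht]

theorem NLS_iff_exists (hG : IsCompact (G : Set 𝔸ˣ)) (hρ : 0 < D.normSqA) (hI : IsOpen I)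
    (hIc : I.OrdConnected) : D.NLS (scaleTime D.normSqA I) q ↔
      ∃ (χ : ℝ → ℝ → D.M) (ψ : ℝ → ℝ → G),
        D.SmoothMap I χ ∧ D.SchrodingerMap I χ ∧ D.HasimotoFrame I χ ψ q := by
  refine ⟨fun hq => ?_, fun ⟨_, _, _, _, h⟩ => h.nls hI hρ⟩
  obtain ⟨χ, ψ, h⟩ := hq.exists_hasimotoFrame hG hρ hI hIc
  exact ⟨χ, ψ, h.parallel.smoothMap, h.schrodinger hI, h⟩

end HermSymm

end Correspondence

/-! ### Spin vectors -/

section Spin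

open Set Filter Topology

variable {𝔸 : Type*} [NormedRing 𝔸] [NormedAlgebra ℝ 𝔸] [FiniteDimensional ℝ 𝔸]
variable {G : Subgroup 𝔸ˣ} {I : Set ℝ}

theorem isAdInv_smul_smul_iff {r : ℝ} (hr : r ≠ 0) {X Y Z : 𝔸} (hX : X ∈ lieAlg G)
    (hZ : Z ∈ lieAlg G) (hsq : ⁅X, ⁅X, Z⁆⁆ = -Z) :
    IsAdInv G (r • X) (r • Y) Z ↔ Z = -⁅X, Y⁆ := by
  have himage : ∃ W ∈ lieAlg G, Z = ⁅r • X, W⁆ := by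
    refine ⟨-(r⁻¹ • ⁅X, Z⁆),
      (lieAlg G).neg_mem ((lieAlg G).smul_mem _ ((lieAlg G).lie_mem hX hZ)), ?_⟩
    rw [lie_neg, smul_lie, lie_smul, smul_inv_smul₀ hr, hsq, neg_neg]
  have hres : ⁅r • X, r • Y - ⁅r • X, Z⁆⁆ = (r * r) • (Z + ⁅X, Y⁆) := by
    simp only [lie_sub, smul_lie, lie_smul, hsq]
    module
  rw [IsAdInv, and_iff_right himage, hres, smul_eq_zero, or_iff_right (mul_ne_zero hr hr),
    eq_neg_iff_add_eq_zero]

namespace HermSymm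

variable {D : HermSymm G} {χ : ℝ → ℝ → D.M} {T : ℝ → ℝ → Aff G} {q : ℝ → ℝ → 𝔸} {c : ℝ}

theorem normSq_eq_one (hρ : 0 < D.normSqA) {v : Aff G} {g : G}
    (h : v.vec = (√D.normSqA)⁻¹ • Ad (g : 𝔸ˣ) D.A) : v.normSq = 1 := by
  have hv : Aff.equiv G v = (√D.normSqA)⁻¹ • adEquiv g ⟨D.A, D.A_mem_lieAlg⟩ := Subtype.ext h
  rw [Aff.normSq, hv, map_smul, map_smul, LinearMap.smul_apply,
    LieAlgebra.killingForm_of_equiv_apply, smul_smul, ← smul_neg, ← normSqA, smul_eq_mul,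
    ← mul_inv, Real.mul_self_sqrt hρ.le, inv_mul_cancel₀ hρ.ne']

theorem exists_corresponds (c : ℝ) (I : Set ℝ) (χ : ℝ → ℝ → D.M) : ∃ T, D.Corresponds c I χ T := by
  refine ⟨fun x t => (Aff.equiv G).symm ⟨(√D.normSqA)⁻¹ • D.emb (χ x (c * t)),
    (lieAlg G).smul_mem _ (D.emb_mem _)⟩, fun x t _ => ?_⟩
  rw [Aff.vec, Equiv.apply_symm_apply]

theorem SpinVector.exists_corresponds (hT : D.SpinVector (scaleTime c I) T) (hc : 0 < c)
    (hρ : 0 < D.normSqA) : ∃ χ, D.SmoothMap I χ ∧ D.Corresponds c I χ T := by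
  have htype : ∀ x t, ∃ g : G, t ∈ I →
      (T x (c⁻¹ * t)).vec = (√D.normSqA)⁻¹ • Ad (g : 𝔸ˣ) D.A := by
    intro x t
    by_cases ht : t ∈ I
    · obtain ⟨g, hg, hTg⟩ := hT.type x (c⁻¹ * t)
        (by rwa [← div_eq_inv_mul, div_mem_scaleTime_iff hc.ne'])
      exact ⟨⟨g, hg⟩, fun _ => hTg⟩
    · exact ⟨1, fun h => (ht h).elim⟩
  choose g hg using htype
  refine ⟨fun x t => QuotientGroup.mk (g x t), ?_, fun x t ht => ?_⟩
  · have hsmooth := (hT.smooth.scaleTime c⁻¹).const_smul √D.normSqA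
    rw [scaleTime_inv_scaleTime hc.ne'] at hsmooth
    refine hsmooth.congr fun x t ht => ?_
    rw [D.emb_mk, hg x t ht, smul_inv_smul₀ (Real.sqrt_pos.2 hρ).ne']
  · rw [D.emb_mk, ← hg x (c * t) ht, inv_mul_cancel_left₀ hc.ne']

theorem SmoothMap.dx_dx_mem (hχ : D.SmoothMap I χ) (hI : IsOpen I) (x : ℝ) {t : ℝ}
    (ht : t ∈ I) : dx (dx fun x t => D.emb (χ x t)) x t ∈ lieAlg G :=
  mem_submodule_of_hasDerivAt (lieAlg G).toSubmodule
    (Smooth.hasDerivAt_dx (Smooth.dx hχ hI) hI x ht) (.of_forall fun y => hχ.dx_mem hI y ht)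

theorem SmoothMap.schrodingerMap_iff (hχ : D.SmoothMap I χ) (hI : IsOpen I) :
    D.SchrodingerMap I χ ↔ ∀ x, ∀ t ∈ I, dt (fun x t => D.emb (χ x t)) x t =
      -⁅D.emb (χ x t), dx (dx fun x t => D.emb (χ x t)) x t⁆ := by
  refine forall₃_congr fun x t ht => ?_
  have hcube := D.Jmap_cube (χ x t) (hχ.dx_dx_mem hI x ht)
  simp only [Jmap] at hcube
  simp only [covDx, tangentProj, Jmap, lie_neg, neg_neg, hcube]

namespace Corresponds

theorem spinVector (h : D.Corresponds c I χ T) (hχ : D.SmoothMap I χ) (hρ : 0 < D.normSqA) :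
    D.SpinVector (scaleTime c I) T := by
  have htype (x : ℝ) {t : ℝ} (ht : t ∈ scaleTime c I) :
      ∃ g : G, (T x t).vec = (√D.normSqA)⁻¹ • Ad (g : 𝔸ˣ) D.A := by
    obtain ⟨g, hg⟩ := QuotientGroup.mk_surjective (χ x (c * t))
    exact ⟨g, by rw [h x t ht, ← hg, D.emb_mk]⟩
  refine ⟨((Smooth.scaleTime hχ c).const_smul _).congr h, fun x t ht => ?_, fun x t ht => ?_⟩
  · obtain ⟨g, hg⟩ := htype x ht
    exact normSq_eq_one hρ hg
  · obtain ⟨g, hg⟩ := htype x ht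
    exact ⟨g, g.2, hg⟩

variable (h : D.Corresponds c I χ T) (hχ : D.SmoothMap I χ) (hI : IsOpen I)

include h hχ hI

theorem dt_vec (x : ℝ) {t : ℝ} (ht : t ∈ scaleTime c I) : dt (fun x t => (T x t).vec) x t =
    (√D.normSqA)⁻¹ • c • dt (fun x t => D.emb (χ x t)) x (c * t) := by
  rw [← dt_comp_mul]
  exact (dt_congr (isOpen_scaleTime hI c) h x ht).trans
    (((Smooth.scaleTime hχ c).hasDerivAt_dt (isOpen_scaleTime hI c) x ht).const_smul
      (√D.normSqA)⁻¹).deriv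

theorem dx_dx_vec (x : ℝ) {t : ℝ} (ht : t ∈ scaleTime c I) :
    dx (dx fun x t => (T x t).vec) x t =
      (√D.normSqA)⁻¹ • dx (dx fun x t => D.emb (χ x t)) x (c * t) := by
  have hdx (x : ℝ) (t : ℝ) (ht : t ∈ scaleTime c I) : dx (fun x t => (T x t).vec) x t =
      (√D.normSqA)⁻¹ • dx (fun x t => D.emb (χ x t)) x (c * t) :=
    (dx_congr h x ht).trans ((Smooth.hasDerivAt_dx hχ hI x ht).const_smul (√D.normSqA)⁻¹).deriv
  exact (dx_congr hdx x ht).trans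
    ((Smooth.hasDerivAt_dx (Smooth.dx hχ hI) hI x ht).const_smul (√D.normSqA)⁻¹).deriv

end Corresponds

theorem schrodingerMap_iff_heisenberg (hss : LieAlgebra.IsSemisimple ℝ (lieAlg G))
    (hρ : 0 < D.normSqA) (hI : IsOpen I) (hχ : D.SmoothMap I χ)
    (h : D.Corresponds √D.normSqA I χ T) :
    D.SchrodingerMap I χ ↔ Heisenberg (scaleTime √D.normSqA I) T := by
  have hsqrt : √D.normSqA ≠ 0 := (Real.sqrt_pos.2 hρ).ne'
  rw [hχ.schrodingerMap_iff hI, ← forall_scaleTime hsqrt]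
  refine forall₃_congr fun x t ht => ?_
  rw [h x t ht, h.dt_vec hχ hI x ht, h.dx_dx_vec hχ hI x ht, inv_smul_smul₀ hsqrt]
  exact (isAdInv_smul_smul_iff (inv_ne_zero hsqrt) (D.emb_mem _) (hχ.dt_mem hI x ht)
    (D.lie_emb_lie_emb_deriv hss (p := fun s => χ x s) (Smooth.hasDerivAt_dt hχ hI x ht))).symm

theorem schrodingerMap_iff_heisenberg' (hρ : 0 < D.normSqA) (hI : IsOpen I)
    (hχ : D.SmoothMap I χ) (h : D.Corresponds (√D.normSqA)⁻¹ I χ T) :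
    D.SchrodingerMap I χ ↔ Heisenberg' (scaleTime (√D.normSqA)⁻¹ I) T := by
  have hsqrt : (√D.normSqA)⁻¹ ≠ 0 := inv_ne_zero (Real.sqrt_pos.2 hρ).ne'
  rw [hχ.schrodingerMap_iff hI, ← forall_scaleTime hsqrt]
  refine forall₃_congr fun x t ht => ?_
  rw [h x t ht, h.dt_vec hχ hI x ht, h.dx_dx_vec hχ hI x ht, smul_lie, lie_smul, ← smul_neg,
    ← smul_neg, smul_right_inj hsqrt, smul_right_inj hsqrt]

theorem NLS_iff_exists_heisenberg (hG : IsCompact (G : Set 𝔸ˣ))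
    (hss : LieAlgebra.IsSemisimple ℝ (lieAlg G)) (hρ : 0 < D.normSqA) (hI : IsOpen I)
    (hIc : I.OrdConnected) : D.NLS (scaleTime D.normSqA I) q ↔
      ∃ (T : ℝ → ℝ → Aff G) (χ : ℝ → ℝ → D.M) (ψ : ℝ → ℝ → G),
        D.SpinVector (scaleTime √D.normSqA I) T ∧ Heisenberg (scaleTime √D.normSqA I) T ∧
        D.HasimotoFrame I χ ψ q ∧ D.Corresponds √D.normSqA I χ T := by
  refine ⟨fun hq => ?_, fun ⟨_, _, _, _, _, h, _⟩ => h.nls hI hρ⟩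
  obtain ⟨χ, ψ, hχ, hS, h⟩ := (NLS_iff_exists hG hρ hI hIc).1 hq
  obtain ⟨T, hT⟩ := exists_corresponds √D.normSqA I χ
  exact ⟨T, χ, ψ, hT.spinVector hχ hρ,
    (schrodingerMap_iff_heisenberg hss hρ hI hχ hT).1 hS, h, hT⟩

end HermSymm

end Spin

end HermitianNLS

end

theorem mainTheorem9 {𝔸 : Type*} [NormedRing 𝔸] [NormedAlgebra ℝ 𝔸] [FiniteDimensional ℝ 𝔸]
    (G : Subgroup 𝔸ˣ) (hcompact : IsCompact (G : Set 𝔸ˣ))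
    (hss : LieAlgebra.IsSemisimple ℝ (lieAlg G))
    (D : HermSymm G) (hm : D.𝔪 ≠ ⊥)
    (I : Set ℝ) (hI : IsOpen I) (hIc : I.OrdConnected) :
    -- every map has parallel frames, unique up to a time-dependent gauge transformation in `H`
    (∀ χ : ℝ → ℝ → D.M, D.SmoothMap I χ →
      (∃ ψ, D.ParallelFrame I χ ψ) ∧
      ∀ ψ ψ', D.ParallelFrame I χ ψ → D.ParallelFrame I χ ψ' →
        ∃ k : ℝ → G, (∀ t, k t ∈ D.H) ∧ ContDiffOn ℝ ∞ (fun t => ((k t : 𝔸ˣ) : 𝔸)) I ∧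
          ∀ x, ∀ t ∈ I, ψ' x t = ψ x t * k t) ∧
    -- a map with parallel frame `ψ` solves the Schrödinger map equation if and only if, after such
    -- a gauge transformation, the Hasimoto variable undergoes the NLS flow
    (∀ (χ : ℝ → ℝ → D.M) (ψ : ℝ → ℝ → G), D.SmoothMap I χ → D.ParallelFrame I χ ψ →
      (D.SchrodingerMap I χ ↔
        ∃ k : ℝ → G, (∀ t, k t ∈ D.H) ∧ ContDiffOn ℝ ∞ (fun t => ((k t : 𝔸ˣ) : 𝔸)) I ∧
          ∃ q, D.HasimotoFrame I χ (fun x t => ψ x t * k t) q ∧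
            D.NLS (scaleTime D.normSqA I) q)) ∧
    -- the solutions of the NLS flow are exactly the Hasimoto variables of Schrödinger maps
    (∀ q : ℝ → ℝ → 𝔸, D.NLS (scaleTime D.normSqA I) q ↔
      ∃ (χ : ℝ → ℝ → D.M) (ψ : ℝ → ℝ → G),
        D.SmoothMap I χ ∧ D.SchrodingerMap I χ ∧ D.HasimotoFrame I χ ψ q) ∧
    -- a parallel frame whose Hasimoto variable solves the NLS flow belongs to a Schrödinger map up
    -- to a time-dependent rigid motion
    (∀ (χ : ℝ → ℝ → D.M) (ψ : ℝ → ℝ → G) (q : ℝ → ℝ → 𝔸),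
      D.SmoothMap I χ → D.ParallelFrame I χ ψ →
      (∀ x, ∀ t ∈ scaleTime D.normSqA I, q x t = hasimoto ψ x (D.normSqA * t)) →
      D.NLS (scaleTime D.normSqA I) q →
        ∃ g : ℝ → G, ContDiffOn ℝ ∞ (fun t => ((g t : 𝔸ˣ) : 𝔸)) I ∧
          D.SchrodingerMap I (fun x t => g t • χ x t)) ∧
    -- Schrödinger maps modulo `G` correspond one to one to NLS solutions modulo `Ad(H)`
    (∀ (χ χ' : ℝ → ℝ → D.M) (ψ ψ' : ℝ → ℝ → G) (q q' : ℝ → ℝ → 𝔸),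
      D.HasimotoFrame I χ ψ q → D.HasimotoFrame I χ' ψ' q' →
      ((∃ g : G, ∀ x, ∀ t ∈ I, χ' x t = g • χ x t) ↔
        ∃ k ∈ D.H, ∀ x, ∀ t ∈ scaleTime D.normSqA I, q' x t = Ad (k : 𝔸ˣ) (q x t))) ∧
    -- the NLS flow is `H`-invariant
    (∀ q : ℝ → ℝ → 𝔸, D.NLS (scaleTime D.normSqA I) q → ∀ k ∈ D.H,
      D.NLS (scaleTime D.normSqA I) (fun x t => Ad (k : 𝔸ˣ) (q x t))) ∧
    -- maps of a circle of length `L`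
    (∀ (χ : ℝ → ℝ → D.M) (ψ : ℝ → ℝ → G) (q : ℝ → ℝ → 𝔸) (L : ℝ),
      D.HasimotoFrame I χ ψ q →
      ((∀ x, ∀ t ∈ I, χ (x + L) t = χ x t) ↔
        ∃ k ∈ D.H, ∀ x, ∀ t ∈ I, ψ (x + L) t = ψ x t * k)) ∧
    -- smooth maps into `M` are the same as spin vectors, in any time scale
    (∀ c : ℝ, 0 < c →
      (∀ χ : ℝ → ℝ → D.M, D.SmoothMap I χ →
        ∃ T, D.SpinVector (scaleTime c I) T ∧ D.Corresponds c I χ T) ∧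
      (∀ T : ℝ → ℝ → Aff G, D.SpinVector (scaleTime c I) T →
        ∃ χ, D.SmoothMap I χ ∧ D.Corresponds c I χ T)) ∧
    -- the Schrödinger map equation is the Heisenberg spin model, in either normalization
    (∀ (χ : ℝ → ℝ → D.M) (T : ℝ → ℝ → Aff G), D.SmoothMap I χ →
      (D.Corresponds √D.normSqA I χ T →
        (D.SchrodingerMap I χ ↔ Heisenberg (scaleTime √D.normSqA I) T)) ∧
      (D.Corresponds (√D.normSqA)⁻¹ I χ T →
        (D.SchrodingerMap I χ ↔ Heisenberg' (scaleTime (√D.normSqA)⁻¹ I) T))) ∧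
    -- the NLS flow on `q` is the Heisenberg spin model for the vector `T = ‖A‖⁻¹ Ad(ψ) A`
    (∀ q : ℝ → ℝ → 𝔸, D.NLS (scaleTime D.normSqA I) q ↔
      ∃ (T : ℝ → ℝ → Aff G) (χ : ℝ → ℝ → D.M) (ψ : ℝ → ℝ → G),
        D.SpinVector (scaleTime √D.normSqA I) T ∧ Heisenberg (scaleTime √D.normSqA I) T ∧
        D.HasimotoFrame I χ ψ q ∧ D.Corresponds √D.normSqA I χ T) := by
  have hρ : 0 < D.normSqA := D.normSqA_pos hm
  refine ⟨fun χ hχ => ⟨HermSymm.exists_parallelFrame hcompact hss hI hIc hχ,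
      fun ψ ψ' h h' => h.exists_gauge hI h'⟩,
    fun χ ψ _ h => ⟨fun hS => ?_, fun ⟨k, _, _, q, hf, _⟩ => hf.schrodinger hI⟩,
    fun q => HermSymm.NLS_iff_exists hcompact hρ hI hIc,
    fun χ ψ q _ h hqu hq => ?_,
    fun χ χ' ψ ψ' q q' h h' => h.exists_smul_iff hI hIc hρ h',
    fun q hq k hk => hq.map_Ad (isOpen_scaleTime hI _) hk,
    fun χ ψ q L h => h.periodic_iff hI hIc L,
    fun c hc => ⟨fun χ hχ => ?_, fun T hT => hT.exists_corresponds hc hρ⟩,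
    fun χ T hχ => ⟨HermSymm.schrodingerMap_iff_heisenberg hss hρ hI hχ,
      HermSymm.schrodingerMap_iff_heisenberg' hρ hI hχ⟩,
    fun q => HermSymm.NLS_iff_exists_heisenberg hcompact hss hρ hI hIc⟩
  · obtain ⟨k, hkH, hk, hf⟩ := h.exists_normalizing_gauge hcompact hI hIc hS
    exact ⟨k, hkH, hk, _, hf, hf.nls hI hρ⟩
  · obtain ⟨g, hg, hf⟩ := h.exists_normalizing_motion hcompact hρ hI hIc hqu hq
    exact ⟨g, hg, hf.schrodinger hI⟩
  · obtain ⟨T, hT⟩ := HermSymm.exists_corresponds c I χ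
    exact ⟨T, hT.spinVector hχ hρ, hT⟩
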